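/- **Setting.** Let $d\ge 2$ be an integer and $a>0$ real. Put $p=\frac94\left(2+\frac ad\right)$, $A=\frac34\left(2+\frac ad\right)$, and let $x_0\ge 3$ be the real solution of $\frac{x}{p\ln x}=3$. A sensor at $z\in\mathbb R^d$ with $d$-dimensional cube sensing radius $r$ covers the cube $\{x:\ |x_k-z_k|\le r,\ 1\le k\le d\}$. **Algorithm $MV_d(m^d,y)$** (for $m^d$ sensors in a translate $o+[0,y]^d$ of the cube $[0,y]^d$). Sort the sensors by the first coordinate and cut the sorted list into $m$ consecutive groups of $m^{d-1}$ sensors. In the $j$-th group ($1\le j\le m$) move the first coordinate of every sensor to $o_1+\frac{jy}{m}-\frac{y}{2m}$, and then, if $d\ge2$, execute $MV_{d-1}(m^{d-1},y)$ on the group in the remaining $d-1$ coordinates. **Algorithm $LV_d(n)$** (for $n\geq\lceil x_0\rceil$ sensors in $[0,1]^d$). Let $q=\left\lfloor\left(\frac{n}{p\ln n}\right)^{1/d}\right\rfloor$ and divide $[0,1]^d$ into $q^d$ subcubes of side $1/q$. * If some subcube contains fewer than $\frac13\frac{n}{q^d}$ sensors, choose $\lfloor n^{1/d}\rfloor^d$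 of the $n$ sensors uniformly at random and run $MV_d\left(\lfloor n^{1/d}\rfloor^d,1\right)$ on them in $[0,1]^d$. * Otherwise, independently in each subcube, choose $\left\lfloor (A\ln n)^{1/d}\right\rfloor^d$ of its sensors uniformly at random and run $MV_d\left(\left\lfloor (A\ln n)^{1/d}\right\rfloor^d,\frac1q\right)$ on them in this subcube. Sensors that are not chosen do not move. The $a$-total movement is $\sum_{i=1}^n d_i^a$, where $d_i$ is the distance by which the $i$-th sensor is displaced. **Theorem 2.2.** There is a constant $C>0$ that depends only on $d$ and $a$ such that the following holds for all real $f\ge\frac{3^{3/d}}{(3^{1/d}-1)^2}$ and all integers $n\ge\lceil x_0\rceil$. Let $n$ sensors with $d$-dimensional cube sensing radius $r=\frac{f}{2n^{1/d}}$ be placed in $[0,1]^d$. 1. For all initial positions in $[0,1]^d$ the choices required by $LV_d(n)$ are possible, and for every outcome of them the final positions attain coverage: each point of $[0,1]^d$ is covered by some sensor. 2. If the initial positions are independent and uniformly distributed on $[0,1]^d$, then the $a$-total movement of $LV_d(n)$, averaged over the random choices of the algorithm, is an integrable function of the initial positions, and the expected $a$-total movement of $LV_d(n)$ satisfies $$\mathbb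 E\left[\sum_{i=1}^n d_i^a\right]\le C\, n^{1-\frac{a}{2d}}\left(\frac{\ln n}{n}\right)^{\frac{a}{2d}} .$$ This holds both when $d_i$ is the Euclidean distance between the initial and the final position of the $i$-th sensor, and when $d_i$ is the total distance it travels in the axis-parallel moves of the algorithm. -/

import Mathlib

open MeasureTheory

namespace SensorCover

/-- Zero-based rank of the sensor `i` among the sensors of `S`, when they are sorted by the key `x`
(ties are broken by the label of the sensor). -/
noncomputable def rank {n : ℕ} (S : Finset (Fin n)) (x : Fin n → ℝ) (i : Fin n) : ℕ :=
  open Classical in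
  (S.filter fun j => x j < x i ∨ (x j = x i ∧ j < i)).card

/-- The algorithm `MV_d(m ^ d, y)`, run on the set `S` of `m ^ d` sensors in the cube
`o + [0, y] ^ d`; here `X i` is the initial position of the sensor `i` and the value at `i` is its
final position.  The sensors of `S` are sorted by the first coordinate and cut into `m` consecutive
groups of `m ^ (d - 1)` sensors.  In the `j`-th group (`j = 0, …, m - 1`) the first coordinate is
moved to `o + (j + 1) y / m - y / (2 m)`, and then `MV_{d-1}(m ^ (d - 1), y)` is executed on the
group in the remaining coordinates.  In dimension zero nothing is left to do, so that in dimension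
one the sensor of rank `j` is moved to `o + (j + 1) y / m - y / (2 m)`.
Sensors outside `S` do not move. -/
noncomputable def MV {n : ℕ} : (d : ℕ) → (m : ℕ) → (y : ℝ) → (o : Fin d → ℝ) →
    (S : Finset (Fin n)) → (X : Fin n → Fin d → ℝ) → Fin n → Fin d → ℝ
  | 0, _, _, _, _, X => X
  | d + 1, m, y, o, S, X => fun i =>
      open Classical in
      let group : Fin n → ℕ := fun k => rank S (fun l => X l 0) k / m ^ d
      if i ∈ S then
        Fin.cons (α := fun _ => ℝ)
          (o 0 + (((group i : ℝ) + 1) * y / m - y / (2 * m)))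
          (MV d m y (Fin.tail o) (S.filter fun k => group k = group i)
            (fun k => Fin.tail (X k)) i)
      else X i

/-- `p = (9/4) (2 + a/d)`. -/
noncomputable def pConst (d : ℕ) (a : ℝ) : ℝ := 9 / 4 * (2 + a / d)

/-- `A = (3/4) (2 + a/d)`. -/
noncomputable def aConst (d : ℕ) (a : ℝ) : ℝ := 3 / 4 * (2 + a / d)

/-- `⌊(n / (p ln n)) ^ (1/d)⌋`, the number of subcubes along each edge of the unit cube. -/
noncomputable def edgeCells (d : ℕ) (a : ℝ) (n : ℕ) : ℕ :=
  ⌊((n : ℝ) / (pConst d a * Real.log n)) ^ (1 / (d : ℝ))⌋₊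

/-- `⌊(A ln n) ^ (1/d)⌋`; its `d`-th power is the number of sensors chosen in each subcube. -/
noncomputable def edgeChosen (d : ℕ) (a : ℝ) (n : ℕ) : ℕ :=
  ⌊(aConst d a * Real.log n) ^ (1 / (d : ℝ))⌋₊

/-- `⌊n ^ (1/d)⌋`; its `d`-th power is the number of sensors chosen in the fallback case. -/
noncomputable def edgeAll (d n : ℕ) : ℕ := ⌊(n : ℝ) ^ (1 / (d : ℝ))⌋₊

/-- The unit cube is divided into `q ^ d` subcubes of side `1 / q`, indexed by `c` with
`0 ≤ c k < q`; the subcube `c` is the product of the intervals `[c k / q, (c k + 1) / q)`, where the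
right end point is included for `c k = q - 1`.  `cellIndex q x` is the index of the subcube that
contains `x`. -/
noncomputable def cellIndex {d : ℕ} (q : ℕ) (x : Fin d → ℝ) : Fin d → ℕ :=
  fun k => min ⌊(q : ℝ) * x k⌋₊ (q - 1)

/-- The sensors that lie in the subcube with index `c`. -/
noncomputable def occupants {n d : ℕ} (q : ℕ) (X : Fin n → Fin d → ℝ) (c : Fin d → ℕ) :
    Finset (Fin n) :=
  Finset.univ.filter fun i => cellIndex q (X i) = c

/-- Some subcube contains fewer than `(1/3) n / q ^ d` sensors, where `q ^ d` is the number of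
subcubes. -/
def Underpopulated {n d : ℕ} (a : ℝ) (X : Fin n → Fin d → ℝ) : Prop :=
  ∃ c : Fin d → Fin (edgeCells d a n),
    ((occupants (edgeCells d a n) X fun k => (c k : ℕ)).card : ℝ) <
      1 / 3 * ((n : ℝ) / (edgeCells d a n : ℝ) ^ d)

/-- The possible sets of chosen sensors in `LV_d(n)`.  The algorithm picks one of them uniformly at
random.  In the fallback case these are all sets of `⌊n ^ (1/d)⌋ ^ d` sensors.  Otherwise they are
all the sets that consist of exactly `⌊(A ln n) ^ (1/d)⌋ ^ d` sensors of each subcube: a uniformly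
random such set amounts to independent uniformly random choices in the single subcubes. -/
noncomputable def lvChoices {n d : ℕ} (a : ℝ) (X : Fin n → Fin d → ℝ) :
    Finset (Finset (Fin n)) :=
  open Classical in
  if Underpopulated a X then
    Finset.powersetCard (edgeAll d n ^ d) Finset.univ
  else
    Finset.univ.filter fun S => ∀ c : Fin d → Fin (edgeCells d a n),
      (S ∩ occupants (edgeCells d a n) X fun k => (c k : ℕ)).card = edgeChosen d a n ^ d

/-- The final positions of the sensors under `LV_d(n)`, when the initial positions are `X` and `S` is
the set of chosen sensors: in the fallback case `MV_d` is run on `S` in the unit cube, otherwise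
`MV_d` is run in each subcube (with side `y = 1 / q` and lower corner `c / q`) on the chosen sensors
of this subcube. -/
noncomputable def LV {n d : ℕ} (a : ℝ) (X : Fin n → Fin d → ℝ) (S : Finset (Fin n)) :
    Fin n → Fin d → ℝ :=
  open Classical in
  if Underpopulated a X then
    MV d (edgeAll d n) 1 0 S X
  else fun i =>
    let q : ℕ := edgeCells d a n
    let c : Fin d → ℕ := cellIndex q (X i)
    MV d (edgeChosen d a n) (1 / q) (fun k => (c k : ℝ) / q) (S ∩ occupants q X c) X i

/-- Each point of the unit cube is within the range of a sensor; the range of a sensor at `z` with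
cube sensing radius `r` is the cube with vertices `(z 1 ± r, …, z d ± r)`. -/
def Covers {n d : ℕ} (r : ℝ) (Z : Fin n → Fin d → ℝ) : Prop :=
  ∀ x ∈ Set.Icc (0 : Fin d → ℝ) 1, ∃ i, ∀ k, |x k - Z i k| ≤ r

/-- The Euclidean distance between the initial and the final position of a sensor. -/
noncomputable def euclideanDisplacement {d : ℕ} (x z : Fin d → ℝ) : ℝ :=
  Real.sqrt (∑ k, (z k - x k) ^ 2)

/-- The length of the path of a sensor that is moved from `x` to `z` by `MV_d`: each single move
changes one coordinate only, and each coordinate is changed at most once. -/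
def distanceTravelled {d : ℕ} (x z : Fin d → ℝ) : ℝ := ∑ k, |z k - x k|

/-- The `a`-total movement `∑ i, d_i ^ a`, where the distance `d_i` is measured by `δ`. -/
noncomputable def totalMovement {n d : ℕ} (δ : (Fin d → ℝ) → (Fin d → ℝ) → ℝ) (a : ℝ)
    (X Z : Fin n → Fin d → ℝ) : ℝ :=
  ∑ i, δ (X i) (Z i) ^ a

/-- The expectation of the `a`-total movement of `LV_d(n)` over the random choice of the sensors that
the algorithm makes, for given initial positions `X`. -/
noncomputable def meanMovement {n d : ℕ} (δ : (Fin d → ℝ) → (Fin d → ℝ) → ℝ) (a : ℝ)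
    (X : Fin n → Fin d → ℝ) : ℝ :=
  (∑ S ∈ lvChoices a X, totalMovement δ a X (LV a X S)) / (lvChoices a X).card

/-- The joint law of `n` independent points that are uniformly distributed on `[0, 1] ^ d`. -/
noncomputable def sensorLaw (n d : ℕ) : Measure (Fin n → Fin d → ℝ) :=
  Measure.pi fun _ => (volume : Measure (Fin d → ℝ)).restrict (Set.Icc 0 1)

end SensorCover

/-!
# Coverage by randomly placed sensors: why the bound holds

**Coverage.** `MV_d(m ^ d, y)` sends its sensors to the centres of the `m ^ d` subcubes of side `y
/ m`, one sensor to each (`card_sortedGroup`, `MV_covers`), wherever they come from. Hence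
coverage is a matter of comparing the radius with the grid step: rounding `d`-th roots of numbers
`≥ 3` down costs at most the factor `(T - 1) / T`, `T = 3 ^ (1/d)` (`floor_rpow_bounds`), and the
equation for `x₀` makes all these numbers at least `3` (`log_bounds`).

**Movement of `MV`.** Given its position, the rank of a uniformly distributed sensor among `N` is
binomial, so its empirical quantile deviates from its position by about `y / √N`; all moments
follow from a bound for the moment generating function (`lintegral_exp_rank_le`,
`exists_lintegral_rank_deviation_le`). The coordinates are independent, so the group to which a
sensor belongs carries no information on its remaining coordinates, and induction on the dimension
bounds the `b`-th moment of the displacement by a multiple of `(y / √m) ^ b`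
(`exists_lintegral_deviation_MV_le`).

**Movement of `LV`.** Condition on the subcube of every sensor. This fixes the case of the
algorithm and its possible choices, and leaves the sensors independent and uniform in their
subcubes (`sensorLaw_restrict_cells`), so in the regular case the bound for `MV` applies in each
subcube (`lintegral_regular_le`).

The fallback case has probability at most `n ^ (-5a/(8d))` by a Chernoff bound and a union bound
(`sensorLaw_underpopulated_le`).  On this event the sensors are no longer independent.  Therefore
the `a`-th power `u` of a displacement is not averaged conditionally, but bounded by
`u ≤ θ + θ⁻⁴ u ^ 5` on the event; the first term is multiplied by the probability of the event, and
the fifth power is integrated over the whole space, where the moment bound for `MV` with exponent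
`5a` is available (`lintegral_fallback_le`).  The choice `θ = n ^ (-3a/(8d))` turns both terms into
`n ^ (-a/d)`, which is below the claimed rate (`fallback_rate_le`).
-/

namespace SensorCover

/-! ### Ranks and the groups of the algorithm `MV` -/

lemma rank_lt_rank {n : ℕ} {S : Finset (Fin n)} {x : Fin n → ℝ} {i j : Fin n} (hi : i ∈ S)
    (h : x i < x j ∨ (x i = x j ∧ i < j)) : rank S x i < rank S x j := by
  classical
  unfold rank
  apply Finset.card_lt_card
  rw [Finset.ssubset_iff_of_subset]
  · exact ⟨i, by simp [hi, h], by simp⟩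
  · intro k hk
    simp only [Finset.mem_filter] at hk ⊢
    refine ⟨hk.1, ?_⟩
    rcases hk.2 with h1 | ⟨h1, h2⟩ <;> rcases h with h3 | ⟨h3, h4⟩
    · exact Or.inl (h1.trans h3)
    · exact Or.inl (h1.trans_eq h3)
    · exact Or.inl (h1.trans_lt h3)
    · exact Or.inr ⟨h1.trans h3, h2.trans h4⟩

lemma rank_injOn {n : ℕ} (S : Finset (Fin n)) (x : Fin n → ℝ) : Set.InjOn (rank S x) S := by
  intro i hi j hj hij
  by_contra hne
  rcases lt_trichotomy (x i) (x j) with h | h | h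
  · exact (rank_lt_rank hi (Or.inl h)).ne hij
  · rcases lt_or_gt_of_ne hne with h' | h'
    · exact (rank_lt_rank hi (Or.inr ⟨h, h'⟩)).ne hij
    · exact (rank_lt_rank hj (Or.inr ⟨h.symm, h'⟩)).ne' hij
  · exact (rank_lt_rank hj (Or.inl h)).ne' hij

lemma rank_lt_card {n : ℕ} {S : Finset (Fin n)} (x : Fin n → ℝ) {i : Fin n} (hi : i ∈ S) :
    rank S x i < S.card := by
  classical
  unfold rank
  apply Finset.card_lt_card
  rw [Finset.ssubset_iff_of_subset (Finset.filter_subset _ _)]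
  exact ⟨i, hi, by simp⟩

lemma image_rank {n : ℕ} (S : Finset (Fin n)) (x : Fin n → ℝ) :
    S.image (rank S x) = Finset.range S.card := by
  apply Finset.eq_of_subset_of_card_le
  · intro r hr
    obtain ⟨i, hi, rfl⟩ := Finset.mem_image.1 hr
    exact Finset.mem_range.2 (rank_lt_card x hi)
  · rw [Finset.card_range, Finset.card_image_of_injOn (rank_injOn S x)]

/-- The `g`-th group (counted from zero) when the sensors of `S` are sorted by the key `x` and cut
into consecutive groups of `M` sensors. -/
noncomputable def sortedGroup {n : ℕ} (M : ℕ) (S : Finset (Fin n)) (x : Fin n → ℝ) (g : ℕ) :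
    Finset (Fin n) :=
  S.filter fun k => rank S x k / M = g

lemma card_sortedGroup {n M m : ℕ} {S : Finset (Fin n)} (x : Fin n → ℝ) (hM : 0 < M)
    (hS : S.card = M * m) {g : ℕ} (hg : g < m) : (sortedGroup M S x g).card = M := by
  have h1 : (sortedGroup M S x g).image (rank S x) = Finset.Ico (g * M) (g * M + M) := by
    ext r
    simp only [sortedGroup, Finset.mem_image, Finset.mem_filter, Finset.mem_Ico]
    constructor
    · rintro ⟨i, ⟨-, rfl⟩, rfl⟩
      exact ⟨Nat.div_mul_le_self _ _, Nat.lt_div_mul_add hM⟩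
    · rintro ⟨h1, h2⟩
      have hr : r ∈ S.image (rank S x) := by
        rw [image_rank, Finset.mem_range, hS]
        calc r < g * M + M := h2
          _ = M * (g + 1) := by ring
          _ ≤ M * m := Nat.mul_le_mul_left _ hg
      obtain ⟨i, hi, rfl⟩ := Finset.mem_image.1 hr
      refine ⟨i, ⟨hi, ?_⟩, rfl⟩
      rw [Nat.div_eq_iff hM]
      omega
  have h2 := congrArg Finset.card h1
  have hsub : sortedGroup M S x g ⊆ S := Finset.filter_subset _ _
  rw [Finset.card_image_of_injOn ((rank_injOn S x).mono (Finset.coe_subset.2 hsub)),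
    Nat.card_Ico] at h2
  omega

lemma rank_div_lt {n M m : ℕ} {S : Finset (Fin n)} (x : Fin n → ℝ)
    (hS : S.card = M * m) {i : Fin n} (hi : i ∈ S) : rank S x i / M < m :=
  Nat.div_lt_of_lt_mul (hS ▸ rank_lt_card x hi)

/-- The first coordinate to which `MV` sends the group `g` (counted from zero): the midpoint of the
`g`-th of the `m` intervals into which `[o, o + y]` is divided. -/
noncomputable def slotCenter (m : ℕ) (y o : ℝ) (g : ℕ) : ℝ :=
  o + (((g : ℝ) + 1) * y / m - y / (2 * m))

lemma MV_succ {n d m : ℕ} {y : ℝ} {o : Fin (d + 1) → ℝ} {S : Finset (Fin n)}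
    {X : Fin n → Fin (d + 1) → ℝ} {i : Fin n} (hi : i ∈ S) :
    MV (d + 1) m y o S X i = Fin.cons (α := fun _ => ℝ)
      (slotCenter m y (o 0) (rank S (fun l => X l 0) i / m ^ d))
      (MV d m y (Fin.tail o)
        (sortedGroup (m ^ d) S (fun l => X l 0) (rank S (fun l => X l 0) i / m ^ d))
        (fun k => Fin.tail (X k)) i) := by
  simp only [MV, hi, if_true, slotCenter, sortedGroup]

lemma MV_of_notMem {n d m : ℕ} {y : ℝ} {o : Fin d → ℝ} {S : Finset (Fin n)}
    {X : Fin n → Fin d → ℝ} {i : Fin n} (hi : i ∉ S) : MV d m y o S X i = X i := by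
  cases d with
  | zero => rfl
  | succ d => simp only [MV, hi, if_false]

/-! ### Coverage -/

lemma exists_slotCenter_near {m : ℕ} (hm : 0 < m) {y o x : ℝ} (hy : 0 < y) (h0 : o ≤ x)
    (h1 : x ≤ o + y) : ∃ g < m, |x - slotCenter m y o g| ≤ y / (2 * m) := by
  have hm' : (0 : ℝ) < m := by exact_mod_cast hm
  -- the truncation at `m - 1` only matters at the right end point `x = o + y`
  refine ⟨min ⌊m * ((x - o) / y)⌋₊ (m - 1), by omega, ?_⟩
  set v := (x - o) / y with hv
  have hx : x = o + v * y := by rw [hv]; field_simp; ring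
  have hv0 : 0 ≤ v := div_nonneg (by linarith) hy.le
  have hv1 : v ≤ 1 := (div_le_one hy).2 (by linarith)
  set g := min ⌊m * v⌋₊ (m - 1) with hg
  have hg1 : (g : ℝ) ≤ m * v :=
    (Nat.cast_le.2 (min_le_left _ _)).trans (Nat.floor_le (by positivity))
  have hg2 : m * v ≤ g + 1 := by
    rcases min_choice ⌊m * v⌋₊ (m - 1) with h | h
    · rw [hg, h]; exact (Nat.lt_floor_add_one _).le
    · rw [hg, h, Nat.cast_sub hm]; push_cast; nlinarith
  have e : x - slotCenter m y o g = (m * v - g - 1 / 2) * (y / m) := by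
    rw [hx, slotCenter]; field_simp; ring
  have e2 : y / (2 * m) = 1 / 2 * (y / m) := by field_simp
  rw [e, e2, abs_mul, abs_of_pos (show 0 < y / m by positivity)]
  gcongr
  rw [abs_le]
  constructor <;> linarith

/-- The final positions under `MV` are the centres of a regular grid, hence every point of the cube
is within half a grid step of one of them. -/
lemma MV_covers {n m : ℕ} (hm : 0 < m) {y : ℝ} (hy : 0 < y) {d : ℕ} {o : Fin d → ℝ}
    {S : Finset (Fin n)} (hS : S.card = m ^ d) (X : Fin n → Fin d → ℝ) {x : Fin d → ℝ}
    (hx : ∀ k, o k ≤ x k ∧ x k ≤ o k + y) :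
    ∃ i ∈ S, ∀ k, |x k - MV d m y o S X i k| ≤ y / (2 * m) := by
  induction d generalizing S with
  | zero =>
    obtain ⟨i, hi⟩ := Finset.card_pos.1 (show 0 < S.card by rw [hS]; simp)
    exact ⟨i, hi, fun k => k.elim0⟩
  | succ d ih =>
    obtain ⟨g, hg, hxg⟩ := exists_slotCenter_near hm hy (hx 0).1 (hx 0).2
    have hc := card_sortedGroup (fun l => X l 0) (pow_pos hm d) (by rw [hS, pow_succ]) hg
    obtain ⟨i, hi, hik⟩ := ih (o := Fin.tail o) (x := Fin.tail x) hc
      (fun k => Fin.tail (X k)) (fun k => hx k.succ)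
    have hi' := hi
    simp only [sortedGroup, Finset.mem_filter] at hi'
    refine ⟨i, hi'.1, ?_⟩
    rw [MV_succ hi'.1, hi'.2]
    intro k
    refine Fin.cases ?_ (fun k => ?_) k
    · simpa using hxg
    · exact hik k

/-! ### Measurability -/

/-- A function is measurable if it agrees with a measurable function on each fibre of a measurable
map into a countable discrete space. -/
lemma measurable_of_fiberwise {α β ι : Type*} [MeasurableSpace α] [MeasurableSpace β]
    [MeasurableSpace ι] [Countable ι] [MeasurableSingletonClass ι] {s : α → ι} (hs : Measurable s)
    {f : α → β} (h : ∀ c, ∃ g : α → β, Measurable g ∧ ∀ x, s x = c → f x = g x) :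
    Measurable f := by
  choose g hg hfg using h
  have h1 : Measurable fun p : ι × α => g p.1 p.2 := measurable_from_prod_countable_right hg
  have h2 : f = fun x => g (s x) x := funext fun x => hfg _ x rfl
  rw [h2]
  exact h1.comp (hs.prodMk measurable_id)

lemma measurable_rank {n : ℕ} (S : Finset (Fin n)) (i : Fin n) :
    Measurable fun x : Fin n → ℝ => rank S x i := by
  classical
  have h : (fun x : Fin n → ℝ => rank S x i) =
      fun x => ∑ j ∈ S, if x j < x i ∨ (x j = x i ∧ j < i) then 1 else 0 := by
    ext x
    rw [rank, Finset.card_filter]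
  rw [h]
  refine Finset.measurable_sum _ fun j _ => Measurable.ite ?_ measurable_const measurable_const
  have h1 : MeasurableSet {x : Fin n → ℝ | x j < x i} :=
    measurableSet_lt (measurable_pi_apply j) (measurable_pi_apply i)
  have h2 : MeasurableSet {x : Fin n → ℝ | x j = x i} :=
    measurableSet_eq_fun (measurable_pi_apply j) (measurable_pi_apply i)
  exact h1.union (h2.inter (MeasurableSet.const _))

lemma measurable_MV {n d m : ℕ} {y : ℝ} {o : Fin d → ℝ} (S : Finset (Fin n)) :
    Measurable fun X : Fin n → Fin d → ℝ => MV d m y o S X := by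
  induction d generalizing S with
  | zero => exact measurable_id
  | succ d ih =>
    refine measurable_pi_iff.2 fun i => ?_
    by_cases hi : i ∈ S
    · have hs : Measurable fun (X : Fin n → Fin (d + 1) → ℝ) (k : Fin n) =>
          rank S (fun l => X l 0) k := by
        refine measurable_pi_iff.2 fun k => (measurable_rank S k).comp ?_
        fun_prop
      refine measurable_of_fiberwise hs fun c => ⟨fun X => Fin.cons (α := fun _ => ℝ)
        (slotCenter m y (o 0) (c i / m ^ d))
        (MV d m y (Fin.tail o) (S.filter fun k => c k / m ^ d = c i / m ^ d)
          (fun k => Fin.tail (X k)) i), ?_, fun X hX => ?_⟩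
      · refine measurable_pi_iff.2 fun k => ?_
        refine Fin.cases ?_ (fun k => ?_) k
        · exact measurable_const
        · simp only [Fin.cons_succ]
          refine (measurable_pi_apply k).comp ((measurable_pi_apply i).comp
            ((ih (o := Fin.tail o) _).comp ?_))
          refine measurable_pi_iff.2 fun k => measurable_pi_iff.2 fun l => ?_
          exact (measurable_pi_apply l.succ).comp (measurable_pi_apply k)
      · rw [MV_succ hi, sortedGroup]
        subst hX
        rfl
    · simp only [MV_of_notMem hi]
      exact measurable_pi_apply i

/-! ### Product measures -/

/-- The uniform probability measure on the interval `[o, o + y]`. -/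
noncomputable def unif (o y : ℝ) : Measure ℝ :=
  (ENNReal.ofReal y)⁻¹ • volume.restrict (Set.Icc o (o + y))

lemma isProbabilityMeasure_unif (o : ℝ) {y : ℝ} (hy : 0 < y) :
    IsProbabilityMeasure (unif o y) := by
  constructor
  simp only [unif, Measure.smul_apply, Measure.restrict_apply_univ, Real.volume_Icc, smul_eq_mul]
  rw [add_sub_cancel_left]
  exact ENNReal.inv_mul_cancel (by simpa using hy) ENNReal.ofReal_ne_top

lemma ae_mem_Icc_unif (o y : ℝ) : ∀ᵐ u ∂unif o y, u ∈ Set.Icc o (o + y) :=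
  Measure.ae_smul_measure (ae_restrict_mem measurableSet_Icc) _

lemma unif_apply_of_between {o y u : ℝ} (hy : 0 < y) (hu : u ∈ Set.Icc o (o + y)) {A : Set ℝ}
    (h1 : Set.Iio u ⊆ A) (h2 : A ⊆ Set.Iic u) : unif o y A = ENNReal.ofReal ((u - o) / y) := by
  have key : volume.restrict (Set.Icc o (o + y)) A = ENNReal.ofReal (u - o) := by
    apply le_antisymm
    · calc volume.restrict (Set.Icc o (o + y)) A
          ≤ volume.restrict (Set.Icc o (o + y)) (Set.Iic u) := measure_mono h2
        _ = volume (Set.Iic u ∩ Set.Icc o (o + y)) := Measure.restrict_apply measurableSet_Iic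
        _ ≤ volume (Set.Icc o u) := measure_mono fun x hx => ⟨hx.2.1, hx.1⟩
        _ = _ := Real.volume_Icc
    · calc ENNReal.ofReal (u - o) = volume (Set.Ico o u) := Real.volume_Ico.symm
        _ ≤ volume (Set.Iio u ∩ Set.Icc o (o + y)) :=
          measure_mono fun x hx => ⟨hx.2, hx.1, hx.2.le.trans hu.2⟩
        _ = volume.restrict (Set.Icc o (o + y)) (Set.Iio u) :=
          (Measure.restrict_apply measurableSet_Iio).symm
        _ ≤ _ := measure_mono h1
  rw [unif, Measure.smul_apply, key, smul_eq_mul, ENNReal.ofReal_div_of_pos hy, mul_comm]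
  rfl

/-- Resampling one coordinate of a product measure does not change the law. -/
lemma measurePreserving_update {ι : Type*} [Fintype ι] [DecidableEq ι] {α : ι → Type*}
    [∀ i, MeasurableSpace (α i)] (μ : ∀ i, Measure (α i)) [∀ i, IsProbabilityMeasure (μ i)]
    (i : ι) : MeasurePreserving (fun p : α i × (∀ j, α j) => Function.update p.2 i p.1)
      ((μ i).prod (Measure.pi μ)) (Measure.pi μ) := by
  have hm : Measurable fun p : α i × (∀ j, α j) => Function.update p.2 i p.1 := by
    refine measurable_pi_iff.2 fun j => ?_
    by_cases h : j = i
    · subst h; simpa using measurable_fst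
    · simp only [Function.update_of_ne h]; fun_prop
  refine ⟨hm, (Measure.pi_eq fun s hs => ?_).symm⟩
  rw [Measure.map_apply hm (MeasurableSet.univ_pi hs)]
  have : (fun p : α i × (∀ j, α j) => Function.update p.2 i p.1) ⁻¹' Set.univ.pi s =
      s i ×ˢ Set.univ.pi (Function.update s i Set.univ) := by
    ext p
    simp only [Set.mem_preimage, Set.mem_univ_pi, Set.mem_prod]
    constructor
    · intro h
      refine ⟨by simpa using h i, fun j => ?_⟩
      by_cases hj : j = i
      · subst hj; simp
      · simpa [Function.update_of_ne hj] using h j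
    · rintro ⟨h1, h2⟩ j
      by_cases hj : j = i
      · subst hj; simpa using h1
      · simpa [Function.update_of_ne hj] using h2 j
  rw [this, Measure.prod_prod, Measure.pi_pi, ← Finset.mul_prod_erase _ _ (Finset.mem_univ i),
    ← Finset.mul_prod_erase _ (fun j => μ j (s j)) (Finset.mem_univ i)]
  simp only [Function.update_self, measure_univ, one_mul]
  congr 1
  refine Finset.prod_congr rfl fun j hj => ?_
  rw [Function.update_of_ne (Finset.ne_of_mem_erase hj)]

lemma lintegral_pi_prod {ι : Type*} [Fintype ι] {α : ι → Type*}
    [∀ i, MeasurableSpace (α i)] (μ : ∀ i, Measure (α i)) [∀ i, IsProbabilityMeasure (μ i)]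
    {f : ∀ i, α i → ENNReal} (hf : ∀ i, Measurable (f i)) :
    ∫⁻ x, ∏ i, f i (x i) ∂Measure.pi μ = ∏ i, ∫⁻ x, f i x ∂μ i := by
  have h := ProbabilityTheory.iIndepFun_pi (μ := μ) (X := f) fun i => (hf i).aemeasurable
  have h2 := ProbabilityTheory.lintegral_prod_eq_prod_lintegral_of_indepFun Finset.univ _ h
    (fun i => (hf i).comp (measurable_pi_apply i))
  rw [h2]
  refine Finset.prod_congr rfl fun i _ => ?_
  exact (measurePreserving_eval μ i).lintegral_comp (hf i)

lemma pi_smul_measure {ι : Type*} [Fintype ι] {α : ι → Type*}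
    [∀ i, MeasurableSpace (α i)] (μ : ∀ i, Measure (α i)) [∀ i, IsFiniteMeasure (μ i)]
    {c : ENNReal} (hc : c ≠ ⊤) :
    Measure.pi (fun i => c • μ i) = c ^ Fintype.card ι • Measure.pi μ := by
  have : ∀ i, IsFiniteMeasure (c • μ i) := fun i => Measure.smul_finite _ hc
  refine Measure.pi_eq fun s _ => ?_
  simp [Measure.pi_pi, Finset.prod_mul_distrib]

/-! ### Moments of the deviation of empirical ranks -/

/-- The moment generating function of a centred Bernoulli variable. -/
lemma bernoulli_mgf_le {v l : ℝ} (hv0 : 0 ≤ v) (hv1 : v ≤ 1) (hl : |l| ≤ 1) :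
    v * Real.exp (l * (1 - v)) + (1 - v) * Real.exp (l * (0 - v)) ≤ Real.exp (l ^ 2) := by
  have key : ∀ x : ℝ, |x| ≤ 1 → Real.exp x ≤ 1 + x + x ^ 2 := fun x hx => by
    have := (abs_le.1 (Real.abs_exp_sub_one_sub_id_le hx)).2; linarith
  have h1 := key (l * (1 - v)) (by
    rw [abs_mul, abs_of_nonneg (by linarith : 0 ≤ 1 - v)]; nlinarith [abs_nonneg l])
  have h2 := key (l * (0 - v)) (by
    rw [abs_mul, zero_sub, abs_neg, abs_of_nonneg hv0]; nlinarith [abs_nonneg l])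
  have h3 := Real.add_one_le_exp (l ^ 2)
  have h4 := mul_le_mul_of_nonneg_left h1 hv0
  have h5 := mul_le_mul_of_nonneg_left h2 (by linarith : 0 ≤ 1 - v)
  nlinarith [mul_nonneg (sq_nonneg l) (sq_nonneg v), mul_nonneg (sq_nonneg l) (sub_nonneg.2 hv1),
    mul_nonneg (mul_nonneg (sq_nonneg l) hv0) hv0]

open Classical in
/-- Indicator of the event that the sensor `j` with key `s` precedes the sensor `i` with key `u` in
the order that defines `rank`. -/
noncomputable def precedes {n : ℕ} (i j : Fin n) (u s : ℝ) : ℝ :=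
  if s < u ∨ (s = u ∧ j < i) then 1 else 0

lemma measurable_precedes {n : ℕ} (i j : Fin n) :
    Measurable fun p : ℝ × ℝ => precedes i j p.1 p.2 := by
  classical
  refine Measurable.ite ?_ measurable_const measurable_const
  exact (measurableSet_lt measurable_snd measurable_fst).union
    ((measurableSet_eq_fun measurable_snd measurable_fst).inter (MeasurableSet.const _))

lemma rank_eq_sum_precedes {n : ℕ} {S : Finset (Fin n)} (x : Fin n → ℝ) (i : Fin n) :
    (rank S x i : ℝ) = ∑ j ∈ S.erase i, precedes i j (x i) (x j) := by
  classical
  have h0 : precedes i i (x i) (x i) = 0 := by simp [precedes]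
  have : ∑ j ∈ S.erase i, precedes i j (x i) (x j) = ∑ j ∈ S, precedes i j (x i) (x j) :=
    Finset.sum_erase _ h0
  rw [this, rank, Finset.card_filter]
  push_cast
  rfl

lemma lintegral_exp_precedes_le {n : ℕ} (i j : Fin n) {o y u l : ℝ} (hy : 0 < y)
    (hu : u ∈ Set.Icc o (o + y)) (hl : |l| ≤ 1) :
    ∫⁻ s, ENNReal.ofReal (Real.exp (l * (precedes i j u s - (u - o) / y))) ∂unif o y
      ≤ ENNReal.ofReal (Real.exp (l ^ 2)) := by
  classical
  have := isProbabilityMeasure_unif o hy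
  set v := (u - o) / y with hv
  have hv0 : 0 ≤ v := div_nonneg (by linarith [hu.1]) hy.le
  have hv1 : v ≤ 1 := (div_le_one hy).2 (by linarith [hu.2])
  set A : Set ℝ := {s | s < u ∨ (s = u ∧ j < i)} with hA
  have hAm : MeasurableSet A :=
    (measurableSet_lt measurable_id measurable_const).union
      ((measurableSet_eq_fun measurable_id measurable_const).inter (MeasurableSet.const _))
  have hA1 : unif o y A = ENNReal.ofReal v := unif_apply_of_between hy hu
    (fun s hs => Or.inl hs) (fun s hs => hs.elim (fun h => h.le) (fun h => h.1.le))
  have hA2 : unif o y Aᶜ = ENNReal.ofReal (1 - v) := by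
    rw [prob_compl_eq_one_sub hAm, hA1, ENNReal.ofReal_sub _ hv0, ENNReal.ofReal_one]
  rw [← lintegral_add_compl _ hAm]
  have e1 : ∫⁻ s in A, ENNReal.ofReal (Real.exp (l * (precedes i j u s - v))) ∂unif o y =
      ENNReal.ofReal (v * Real.exp (l * (1 - v))) := by
    rw [setLIntegral_congr_fun (g := fun _ => ENNReal.ofReal (Real.exp (l * (1 - v)))) hAm
      (fun s hs => by
        have h : precedes i j u s = 1 := if_pos hs
        simp only [h])]
    rw [setLIntegral_const, hA1, mul_comm, ENNReal.ofReal_mul hv0]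
  have e2 : ∫⁻ s in Aᶜ, ENNReal.ofReal (Real.exp (l * (precedes i j u s - v))) ∂unif o y =
      ENNReal.ofReal ((1 - v) * Real.exp (l * (0 - v))) := by
    rw [setLIntegral_congr_fun (g := fun _ => ENNReal.ofReal (Real.exp (l * (0 - v)))) hAm.compl
      (fun s hs => by
        have h : precedes i j u s = 0 := if_neg hs
        simp only [h])]
    rw [setLIntegral_const, hA2, mul_comm, ENNReal.ofReal_mul (by linarith)]
  rw [e1, e2, ← ENNReal.ofReal_add (by positivity)
    (mul_nonneg (by linarith) (Real.exp_pos _).le)]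
  exact ENNReal.ofReal_le_ofReal (bernoulli_mgf_le hv0 hv1 hl)

/-- Exponential moment of the deviation of the rank of a sensor from its conditional mean, given its
own position. -/
lemma lintegral_exp_rank_le {n : ℕ} {S : Finset (Fin n)} {ν : Fin n → Measure ℝ}
    [∀ j, IsProbabilityMeasure (ν j)] {o y l : ℝ} (hy : 0 < y) (hν : ∀ j ∈ S, ν j = unif o y)
    {i : Fin n} (hi : i ∈ S) (hl : |l| ≤ 1) :
    ∫⁻ x, ENNReal.ofReal (Real.exp (l * (rank S x i - (S.erase i).card * ((x i - o) / y))))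
      ∂Measure.pi ν ≤ ENNReal.ofReal (Real.exp (S.card * l ^ 2)) := by
  classical
  set F : (Fin n → ℝ) → ENNReal := fun x =>
    ENNReal.ofReal (Real.exp (l * (rank S x i - (S.erase i).card * ((x i - o) / y)))) with hF
  have hFm : Measurable F := by
    have h1 : Measurable fun x : Fin n → ℝ => (rank S x i : ℝ) :=
      measurable_from_nat.comp (measurable_rank S i)
    have h2 : Measurable fun x : Fin n → ℝ => x i := measurable_pi_apply i
    fun_prop
  rw [← (measurePreserving_update ν i).lintegral_comp hFm, lintegral_prod
    (fun p : ℝ × (Fin n → ℝ) => F (Function.update p.2 i p.1))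
    (hFm.comp (measurePreserving_update ν i).measurable).aemeasurable]
  have hae : ∀ᵐ u ∂ν i, u ∈ Set.Icc o (o + y) := by
    rw [hν i hi]; exact ae_mem_Icc_unif o y
  have hbound : ∀ᵐ u ∂ν i, ∫⁻ x, F (Function.update x i u) ∂Measure.pi ν ≤
      ENNReal.ofReal (Real.exp (S.card * l ^ 2)) := by
    filter_upwards [hae] with u hu
    have e : ∀ x : Fin n → ℝ, F (Function.update x i u) = ∏ j, (if j ∈ S.erase i then
        ENNReal.ofReal (Real.exp (l * (precedes i j u (x j) - (u - o) / y))) else 1) := by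
      intro x
      rw [Finset.prod_ite_mem, Finset.univ_inter,
        ← ENNReal.ofReal_prod_of_nonneg (fun j _ => (Real.exp_pos _).le), ← Real.exp_sum,
        ← Finset.mul_sum, Finset.sum_sub_distrib, Finset.sum_const, nsmul_eq_mul, hF]
      have hr : (rank S (Function.update x i u) i : ℝ) =
          ∑ j ∈ S.erase i, precedes i j u (x j) := by
        rw [rank_eq_sum_precedes]
        refine Finset.sum_congr rfl fun j hj => ?_
        rw [Function.update_of_ne (Finset.ne_of_mem_erase hj), Function.update_self]
      simp only [hr, Function.update_self]
    simp only [e]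
    rw [lintegral_pi_prod ν (f := fun j s => if j ∈ S.erase i then
        ENNReal.ofReal (Real.exp (l * (precedes i j u s - (u - o) / y))) else 1)]
    · calc ∏ j, ∫⁻ s, (if j ∈ S.erase i then
              ENNReal.ofReal (Real.exp (l * (precedes i j u s - (u - o) / y))) else 1) ∂ν j
          ≤ ∏ j, (if j ∈ S then ENNReal.ofReal (Real.exp (l ^ 2)) else 1) := by
            refine Finset.prod_le_prod' fun j _ => ?_
            have h1 : (1 : ENNReal) ≤ ENNReal.ofReal (Real.exp (l ^ 2)) := by
              rw [← ENNReal.ofReal_one]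
              exact ENNReal.ofReal_le_ofReal (Real.one_le_exp (sq_nonneg l))
            by_cases hj : j ∈ S.erase i
            · have hjS := Finset.mem_of_mem_erase hj
              simp only [hj, hjS, if_true]
              rw [hν j hjS]
              exact lintegral_exp_precedes_le i j hy hu hl
            · simp only [hj, if_false, lintegral_const, measure_univ, one_mul]
              split_ifs
              · exact h1
              · exact le_rfl
        _ = ENNReal.ofReal (Real.exp (S.card * l ^ 2)) := by
            rw [Finset.prod_ite_mem, Finset.univ_inter, Finset.prod_const,
              ← ENNReal.ofReal_pow (Real.exp_pos _).le, ← Real.exp_nat_mul]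
    · intro j
      split_ifs
      · have := (measurable_precedes i j).comp (measurable_prodMk_left (x := u))
        simp only [Function.comp_def] at this
        fun_prop
      · exact measurable_const
  calc _ ≤ ∫⁻ _, ENNReal.ofReal (Real.exp (S.card * l ^ 2)) ∂ν i := lintegral_mono_ae hbound
    _ = _ := by simp

lemma exists_rpow_le_exp (b : ℝ) : ∃ K : ℝ, 0 < K ∧ ∀ s : ℝ, 0 ≤ s →
    (s + 1) ^ b ≤ K * Real.exp s := by
  obtain ⟨k, hk⟩ := exists_nat_ge b
  refine ⟨k.factorial * Real.exp 1, by positivity, fun s hs => ?_⟩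
  have h := Real.pow_div_factorial_le_exp (s + 1) (by linarith) k
  rw [div_le_iff₀ (by positivity), Real.exp_add] at h
  calc (s + 1) ^ b ≤ (s + 1) ^ (k : ℝ) := Real.rpow_le_rpow_of_exponent_le (by linarith) hk
    _ = (s + 1) ^ k := Real.rpow_natCast _ _
    _ ≤ _ := by linarith

/-- The moments of the deviation of a uniformly distributed point from its empirical quantile. -/
lemma exists_lintegral_rank_deviation_le {b : ℝ} (hb : 0 < b) : ∃ K : ℝ, 0 < K ∧
    ∀ {n : ℕ} {S : Finset (Fin n)} {ν : Fin n → Measure ℝ} [∀ j, IsProbabilityMeasure (ν j)]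
      {o y : ℝ}, 0 < y → (∀ j ∈ S, ν j = unif o y) → ∀ i ∈ S,
      ∫⁻ x, ENNReal.ofReal (|o + y * (rank S x i / S.card) - x i| ^ b) ∂Measure.pi ν ≤
        ENNReal.ofReal (K * (y / √S.card) ^ b) := by
  obtain ⟨K, hK, hKs⟩ := exists_rpow_le_exp b
  refine ⟨K * (2 * Real.exp 1), by positivity, ?_⟩
  intro n S ν _ o y hy hν i hi
  have hc : 0 < S.card := Finset.card_pos.2 ⟨i, hi⟩
  obtain ⟨N, hN⟩ : ∃ N : ℝ, N = S.card := ⟨_, rfl⟩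
  rw [← hN]
  have hN1 : 1 ≤ N := by rw [hN]; exact_mod_cast hc
  have hr1 : 1 ≤ √N := Real.one_le_sqrt.2 hN1
  have hr0 : 0 < √N := by linarith
  have hcard : ((S.erase i).card : ℝ) = N - 1 := by
    rw [Finset.card_erase_of_mem hi, Nat.cast_sub hc]; simp [hN]
  have hae : ∀ᵐ x ∂Measure.pi ν, x i ∈ Set.Icc o (o + y) := by
    refine (Measure.quasiMeasurePreserving_eval ν i).ae (p := fun u => u ∈ Set.Icc o (o + y)) ?_
    rw [hν i hi]; exact ae_mem_Icc_unif o y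
  set P : ℝ → (Fin n → ℝ) → ENNReal := fun l x => ENNReal.ofReal
    (Real.exp (l * (rank S x i - (S.erase i).card * ((x i - o) / y)))) with hP
  have hPm : ∀ l, Measurable (P l) := fun l => by
    have h1 : Measurable fun x : Fin n → ℝ => (rank S x i : ℝ) :=
      measurable_from_nat.comp (measurable_rank S i)
    have h2 : Measurable fun x : Fin n → ℝ => x i := measurable_pi_apply i
    fun_prop
  have hpt : ∀ᵐ x ∂Measure.pi ν, ENNReal.ofReal (|o + y * (rank S x i / N) - x i| ^ b) ≤
      ENNReal.ofReal (K * (y / √N) ^ b) * (P (1 / √N) x + P (-(1 / √N)) x) := by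
    filter_upwards [hae] with x hx
    set v := (x i - o) / y with hv
    have hv0 : 0 ≤ v := div_nonneg (by linarith [hx.1]) hy.le
    have hv1 : v ≤ 1 := (div_le_one hy).2 (by linarith [hx.2])
    have hxi : x i = o + y * v := by rw [hv]; field_simp; ring
    set Z : ℝ := rank S x i - (S.erase i).card * v with hZ
    have hrank : (rank S x i : ℝ) = Z + (N - 1) * v := by rw [hZ, hcard]; ring
    have h1 : |o + y * (rank S x i / N) - x i| ≤ y / √N * (|Z| / √N + 1) := by
      have e : o + y * (rank S x i / N) - x i = y / N * (Z - v) := by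
        rw [hxi, hrank]; field_simp; ring
      have e2 : y / √N * (|Z| / √N + 1) = y / N * (|Z| + √N) := by
        have : N = √N * √N := (Real.mul_self_sqrt (by linarith)).symm
        nth_rewrite 3 [this]
        field_simp
      rw [e, e2, abs_mul, abs_of_pos (by positivity : 0 < y / N)]
      gcongr
      calc |Z - v| ≤ |Z| + |v| := abs_sub _ _
        _ ≤ |Z| + √N := by rw [abs_of_nonneg hv0]; linarith
    have h2 : |o + y * (rank S x i / N) - x i| ^ b ≤
        K * (y / √N) ^ b * (Real.exp (1 / √N * Z) + Real.exp (-(1 / √N) * Z)) := by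
      calc |o + y * (rank S x i / N) - x i| ^ b ≤ (y / √N * (|Z| / √N + 1)) ^ b := by
            gcongr
        _ = (y / √N) ^ b * (|Z| / √N + 1) ^ b := Real.mul_rpow (by positivity) (by positivity)
        _ ≤ (y / √N) ^ b * (K * Real.exp (|Z| / √N)) := by
            gcongr; exact hKs _ (by positivity)
        _ = K * (y / √N) ^ b * Real.exp (|Z| / √N) := by ring
        _ ≤ _ := by
            gcongr
            rcases abs_cases Z with ⟨h, -⟩ | ⟨h, -⟩ <;> rw [h]
            · have : Z / √N = 1 / √N * Z := by ring
              rw [this]; linarith [Real.exp_pos (-(1 / √N) * Z)]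
            · have : -Z / √N = -(1 / √N) * Z := by ring
              rw [this]; linarith [Real.exp_pos (1 / √N * Z)]
    refine (ENNReal.ofReal_le_ofReal h2).trans (le_of_eq ?_)
    rw [ENNReal.ofReal_mul (by positivity), ENNReal.ofReal_add (by positivity) (by positivity)]
  -- the parameter `1 / √N` makes the exponent `N * (1 / √N) ^ 2` of the bound equal to `1`
  have hl : |1 / √N| ≤ 1 := by
    rw [abs_of_pos (by positivity)]; exact (div_le_one hr0).2 hr1
  have hNl : N * (1 / √N) ^ 2 = 1 := by
    rw [div_pow, Real.sq_sqrt (by linarith)]; field_simp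
  have b1 := lintegral_exp_rank_le hy hν hi hl
  have b2 := lintegral_exp_rank_le (l := -(1 / √N)) hy hν hi (by rwa [abs_neg])
  rw [← hN, hNl] at b1
  rw [← hN, neg_sq, hNl] at b2
  calc _ ≤ ∫⁻ x, ENNReal.ofReal (K * (y / √N) ^ b) * (P (1 / √N) x + P (-(1 / √N)) x)
        ∂Measure.pi ν := lintegral_mono_ae hpt
    _ = ENNReal.ofReal (K * (y / √N) ^ b) * (∫⁻ x, P (1 / √N) x ∂Measure.pi ν +
        ∫⁻ x, P (-(1 / √N)) x ∂Measure.pi ν) := by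
      rw [lintegral_const_mul' _ _ ENNReal.ofReal_ne_top, lintegral_add_left (hPm _)]
    _ ≤ ENNReal.ofReal (K * (y / √N) ^ b) * (ENNReal.ofReal (Real.exp 1) +
        ENNReal.ofReal (Real.exp 1)) := by gcongr
    _ = _ := by
      rw [← ENNReal.ofReal_add (by positivity) (by positivity),
        ← ENNReal.ofReal_mul (by positivity)]
      congr 1; ring

/-! ### Moments of the movement of `MV` -/

/-- The sum of the `b`-th powers of the coordinatewise displacements of the sensors of `S`. -/
noncomputable def deviation {n d : ℕ} (b : ℝ) (S : Finset (Fin n)) (X Z : Fin n → Fin d → ℝ) : ℝ :=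
  ∑ i ∈ S, ∑ k, |Z i k - X i k| ^ b

lemma deviation_nonneg {n d : ℕ} (b : ℝ) (S : Finset (Fin n)) (X Z : Fin n → Fin d → ℝ) :
    0 ≤ deviation b S X Z :=
  Finset.sum_nonneg fun _ _ => Finset.sum_nonneg fun _ _ => Real.rpow_nonneg (abs_nonneg _) _

lemma measurable_deviation_MV {n d m : ℕ} {y : ℝ} {o : Fin d → ℝ} (b : ℝ) (S : Finset (Fin n)) :
    Measurable fun X : Fin n → Fin d → ℝ => deviation b S X (MV d m y o S X) := by
  unfold deviation
  refine Finset.measurable_sum _ fun i _ => Finset.measurable_sum _ fun k _ => ?_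
  have h1 : Measurable fun X : Fin n → Fin d → ℝ => MV d m y o S X i k :=
    (measurable_pi_apply k).comp ((measurable_pi_apply i).comp (measurable_MV S))
  have h2 : Measurable fun X : Fin n → Fin d → ℝ => X i k :=
    (measurable_pi_apply k).comp (measurable_pi_apply i)
  exact (continuous_abs.measurable.comp (h1.sub h2)).pow_const b

lemma deviation_MV_succ {n d m : ℕ} {y b : ℝ} {o : Fin (d + 1) → ℝ} {S : Finset (Fin n)}
    (hS : S.card = m ^ d * m) (X : Fin n → Fin (d + 1) → ℝ) :
    deviation b S X (MV (d + 1) m y o S X) =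
      ∑ i ∈ S, |slotCenter m y (o 0) (rank S (fun l => X l 0) i / m ^ d) - X i 0| ^ b +
      ∑ g ∈ Finset.range m, deviation b (sortedGroup (m ^ d) S (fun l => X l 0) g)
        (fun k => Fin.tail (X k)) (MV d m y (Fin.tail o)
          (sortedGroup (m ^ d) S (fun l => X l 0) g) (fun k => Fin.tail (X k))) := by
  have hmaps : ∀ i ∈ S, rank S (fun l => X l 0) i / m ^ d ∈ Finset.range m := fun i hi =>
    Finset.mem_range.2 (rank_div_lt _ hS hi)
  have h2 : ∑ g ∈ Finset.range m, deviation b (sortedGroup (m ^ d) S (fun l => X l 0) g)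
        (fun k => Fin.tail (X k)) (MV d m y (Fin.tail o)
          (sortedGroup (m ^ d) S (fun l => X l 0) g) (fun k => Fin.tail (X k))) =
      ∑ i ∈ S, ∑ k : Fin d, |MV d m y (Fin.tail o) (sortedGroup (m ^ d) S (fun l => X l 0)
        (rank S (fun l => X l 0) i / m ^ d)) (fun k => Fin.tail (X k)) i k - X i k.succ| ^ b := by
    rw [← Finset.sum_fiberwise_of_maps_to hmaps]
    refine Finset.sum_congr rfl fun g _ => Finset.sum_congr rfl fun i hi => ?_
    have := (Finset.mem_filter.1 hi).2
    subst this
    rfl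
  rw [h2, ← Finset.sum_add_distrib, deviation]
  refine Finset.sum_congr rfl fun i hi => ?_
  rw [MV_succ hi, Fin.sum_univ_succ]
  simp

lemma measurePreserving_splitFirst {n d : ℕ} (ν : Fin n → Fin (d + 1) → Measure ℝ)
    [∀ i k, IsProbabilityMeasure (ν i k)] :
    MeasurePreserving (fun X : Fin n → Fin (d + 1) → ℝ =>
        ((fun i => X i 0, fun i => Fin.tail (X i)) : (Fin n → ℝ) × (Fin n → Fin d → ℝ)))
      (Measure.pi fun i => Measure.pi (ν i))
      ((Measure.pi fun i => ν i 0).prod (Measure.pi fun i => Measure.pi fun k => ν i k.succ)) := by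
  have h1 := measurePreserving_pi (fun i => Measure.pi (ν i)) _
    (fun i => measurePreserving_piFinSuccAbove (ν i) 0)
  have h2 := measurePreserving_arrowProdEquivProdArrow ℝ (Fin d → ℝ) (Fin n) (fun i => ν i 0)
    (fun i => Measure.pi fun k => ν i k.succ)
  exact h2.comp h1

/-- A target of `MV` differs from the empirical quantile of the sensor by at most half a slot. -/
lemma abs_quantile_sub_slotCenter_le {m M r : ℕ} (hm : 0 < m) (hM : 0 < M) {y o : ℝ} (hy : 0 < y) :
    |slotCenter m y o (r / M) - (o + y * ((r : ℝ) / (M * m : ℕ)))| ≤ y / (2 * m) := by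
  have hm' : (0 : ℝ) < m := by exact_mod_cast hm
  have hM' : (0 : ℝ) < M := by exact_mod_cast hM
  have h1 : ((r / M : ℕ) : ℝ) ≤ r / M := Nat.cast_div_le
  have h2 : (r : ℝ) / M ≤ ((r / M : ℕ) : ℝ) + 1 := by
    rw [div_le_iff₀ hM']
    have := (Nat.lt_div_mul_add (a := r) hM).le
    have : (r : ℝ) ≤ (r / M : ℕ) * M + M := by exact_mod_cast this
    linarith
  have e : slotCenter m y o (r / M) - (o + y * ((r : ℝ) / (M * m : ℕ))) =
      (((r / M : ℕ) : ℝ) + 1 / 2 - r / M) * (y / m) := by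
    rw [slotCenter]; push_cast; field_simp; ring
  have e2 : y / (2 * m) = 1 / 2 * (y / m) := by field_simp
  rw [e, e2, abs_mul, abs_of_pos (show 0 < y / m by positivity)]
  gcongr
  rw [abs_le]
  constructor <;> linarith

lemma add_rpow_le_two_rpow_mul {b u v : ℝ} (hb : 0 < b) (hu : 0 ≤ u) (hv : 0 ≤ v) :
    (u + v) ^ b ≤ 2 ^ b * (u ^ b + v ^ b) := by
  have h : u + v ≤ 2 * max u v := by
    linarith [le_max_left u v, le_max_right u v]
  calc (u + v) ^ b ≤ (2 * max u v) ^ b := by gcongr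
    _ = 2 ^ b * max u v ^ b := Real.mul_rpow (by norm_num) (le_max_of_le_left hu)
    _ ≤ 2 ^ b * (u ^ b + v ^ b) := by
      gcongr
      rcases max_choice u v with h | h <;> rw [h]
      · linarith [Real.rpow_nonneg hv b]
      · linarith [Real.rpow_nonneg hu b]

/-- The moments of the displacement along the first coordinate axis. -/
lemma exists_lintegral_slotCenter_le {b : ℝ} (hb : 0 < b) : ∃ K : ℝ, 0 < K ∧
    ∀ {n M m : ℕ} {S : Finset (Fin n)} {ν : Fin n → Measure ℝ} [∀ j, IsProbabilityMeasure (ν j)]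
      {o y : ℝ}, 0 < y → 0 < m → 0 < M → S.card = M * m → (∀ j ∈ S, ν j = unif o y) → ∀ i ∈ S,
      ∫⁻ x, ENNReal.ofReal (|slotCenter m y o (rank S x i / M) - x i| ^ b) ∂Measure.pi ν ≤
        ENNReal.ofReal (K * (y / √m) ^ b) := by
  obtain ⟨K, hK, hKs⟩ := exists_lintegral_rank_deviation_le hb
  refine ⟨2 ^ b * (K + 1), by positivity, ?_⟩
  intro n M m S ν _ o y hy hm hM hS hν i hi
  have hm' : (1 : ℝ) ≤ m := by exact_mod_cast hm
  have hs1 : 1 ≤ √(m : ℝ) := Real.one_le_sqrt.2 hm'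
  have hsm : √(m : ℝ) ≤ m := (Real.sqrt_le_left (by positivity)).2 (by nlinarith)
  have hcard : y / √(S.card : ℝ) ≤ y / √m := by
    gcongr
    rw [hS]; exact Nat.le_mul_of_pos_left m hM
  have hstep : y / (2 * m) ≤ y / √m := by
    gcongr; linarith
  have hpt : ∀ x : Fin n → ℝ,
      ENNReal.ofReal (|slotCenter m y o (rank S x i / M) - x i| ^ b) ≤
        ENNReal.ofReal (2 ^ b) * (ENNReal.ofReal (|o + y * (rank S x i / S.card) - x i| ^ b) +
          ENNReal.ofReal ((y / √m) ^ b)) := by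
    intro x
    rw [← ENNReal.ofReal_add (by positivity) (by positivity),
      ← ENNReal.ofReal_mul (by positivity)]
    apply ENNReal.ofReal_le_ofReal
    refine le_trans ?_ (add_rpow_le_two_rpow_mul hb (abs_nonneg _) (by positivity))
    gcongr
    have h1 := abs_quantile_sub_slotCenter_le (r := rank S x i) (o := o) hm hM hy
    rw [← hS] at h1
    calc |slotCenter m y o (rank S x i / M) - x i|
        ≤ |slotCenter m y o (rank S x i / M) - (o + y * (rank S x i / S.card))| +
          |o + y * (rank S x i / S.card) - x i| := abs_sub_le _ _ _
      _ ≤ _ := by linarith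
  calc _ ≤ ∫⁻ x, ENNReal.ofReal (2 ^ b) *
        (ENNReal.ofReal (|o + y * (rank S x i / S.card) - x i| ^ b) +
          ENNReal.ofReal ((y / √m) ^ b)) ∂Measure.pi ν := lintegral_mono hpt
    _ = ENNReal.ofReal (2 ^ b) *
        (∫⁻ x, ENNReal.ofReal (|o + y * (rank S x i / S.card) - x i| ^ b) ∂Measure.pi ν +
          ENNReal.ofReal ((y / √m) ^ b)) := by
      rw [lintegral_const_mul' _ _ ENNReal.ofReal_ne_top, lintegral_add_right _ measurable_const]
      simp
    _ ≤ ENNReal.ofReal (2 ^ b) *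
        (ENNReal.ofReal (K * (y / √m) ^ b) + ENNReal.ofReal ((y / √m) ^ b)) := by
      gcongr
      refine (hKs hy hν i hi).trans (ENNReal.ofReal_le_ofReal ?_)
      gcongr
    _ = _ := by
      rw [← ENNReal.ofReal_add (by positivity) (by positivity),
        ← ENNReal.ofReal_mul (by positivity)]
      congr 1; ring

lemma measurable_slotCenter_deviation {n : ℕ} (M m : ℕ) (y o b : ℝ) (S : Finset (Fin n))
    (i : Fin n) : Measurable fun x : Fin n → ℝ =>
      ENNReal.ofReal (|slotCenter m y o (rank S x i / M) - x i| ^ b) := by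
  have h0 : Measurable fun r : ℕ => slotCenter m y o (r / M) := measurable_from_nat
  have h1 : Measurable fun x : Fin n → ℝ => slotCenter m y o (rank S x i / M) :=
    h0.comp (measurable_rank S i)
  exact ENNReal.measurable_ofReal.comp
    ((continuous_abs.measurable.comp (h1.sub (measurable_pi_apply i))).pow_const b)

/-- The moments of the movement of `MV_d(m ^ d, y)` for uniformly distributed sensors.  The typical
displacement is `y / √m`: the last coordinate, where only `m` sensors are sorted, dominates. -/
theorem exists_lintegral_deviation_MV_le {b : ℝ} (hb : 0 < b) (d : ℕ) : ∃ K : ℝ, 0 < K ∧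
    ∀ {n m : ℕ} {S : Finset (Fin n)} {ν : Fin n → Fin d → Measure ℝ}
      [∀ i k, IsProbabilityMeasure (ν i k)] {o : Fin d → ℝ} {y : ℝ}, 0 < y → 0 < m →
      S.card = m ^ d → (∀ i ∈ S, ∀ k, ν i k = unif (o k) y) →
      ∫⁻ X, ENNReal.ofReal (deviation b S X (MV d m y o S X)) ∂Measure.pi (fun i => Measure.pi (ν i))
        ≤ ENNReal.ofReal (K * m ^ d * (y / √m) ^ b) := by
  induction d with
  | zero =>
    refine ⟨1, one_pos, ?_⟩
    intro n m S ν _ o y hy hm hS hν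
    simp [deviation]
  | succ d ih =>
    obtain ⟨K, hK, hKs⟩ := ih
    obtain ⟨K', hK', hKs'⟩ := exists_lintegral_slotCenter_le hb
    refine ⟨K' + K, by positivity, ?_⟩
    intro n m S ν _ o y hy hm hS hν
    rw [pow_succ] at hS
    have hmd : 0 < m ^ d := pow_pos hm d
    set F : (Fin n → ℝ) → ENNReal := fun x =>
      ∑ i ∈ S, ENNReal.ofReal (|slotCenter m y (o 0) (rank S x i / m ^ d) - x i| ^ b) with hF
    set G : (Fin n → ℝ) × (Fin n → Fin d → ℝ) → ENNReal := fun p =>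
      ∑ g ∈ Finset.range m, ENNReal.ofReal (deviation b (sortedGroup (m ^ d) S p.1 g) p.2
        (MV d m y (Fin.tail o) (sortedGroup (m ^ d) S p.1 g) p.2)) with hG
    have hFm : Measurable F :=
      Finset.measurable_sum _ fun i _ => measurable_slotCenter_deviation _ _ _ _ _ _ _
    have hGm : Measurable G := by
      refine Finset.measurable_sum _ fun g _ => ENNReal.measurable_ofReal.comp ?_
      have hs : Measurable fun (p : (Fin n → ℝ) × (Fin n → Fin d → ℝ)) (k : Fin n) =>
          rank S p.1 k :=
        measurable_pi_iff.2 fun k => (measurable_rank S k).comp measurable_fst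
      refine measurable_of_fiberwise hs fun c => ⟨fun p => deviation b
        (S.filter fun k => c k / m ^ d = g) p.2
        (MV d m y (Fin.tail o) (S.filter fun k => c k / m ^ d = g) p.2),
        (measurable_deviation_MV b _).comp measurable_snd, fun p hp => ?_⟩
      subst hp
      rfl
    have hsplit : ∀ X : Fin n → Fin (d + 1) → ℝ,
        ENNReal.ofReal (deviation b S X (MV (d + 1) m y o S X)) =
          (fun p : (Fin n → ℝ) × (Fin n → Fin d → ℝ) => F p.1 + G p)
            (fun i => X i 0, fun i => Fin.tail (X i)) := by
      intro X
      rw [deviation_MV_succ hS, ENNReal.ofReal_add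
        (Finset.sum_nonneg fun _ _ => Real.rpow_nonneg (abs_nonneg _) _)
        (Finset.sum_nonneg fun _ _ => deviation_nonneg _ _ _ _),
        ENNReal.ofReal_sum_of_nonneg (fun _ _ => Real.rpow_nonneg (abs_nonneg _) _),
        ENNReal.ofReal_sum_of_nonneg (fun _ _ => deviation_nonneg _ _ _ _)]
    simp only [hsplit]
    rw [(measurePreserving_splitFirst ν).lintegral_comp
      (f := fun p : (Fin n → ℝ) × (Fin n → Fin d → ℝ) => F p.1 + G p)
      ((hFm.comp measurable_fst).add hGm), lintegral_prod
      (fun p : (Fin n → ℝ) × (Fin n → Fin d → ℝ) => F p.1 + G p)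
      ((hFm.comp measurable_fst).add hGm).aemeasurable]
    have hinner : ∀ x : Fin n → ℝ,
        ∫⁻ Y, (F x + G (x, Y)) ∂(Measure.pi fun i => Measure.pi fun k : Fin d => ν i k.succ) ≤
          F x + ENNReal.ofReal (m * (K * m ^ d * (y / √m) ^ b)) := by
      intro x
      rw [lintegral_add_left measurable_const]
      simp only [lintegral_const, measure_univ, mul_one]
      gcongr
      simp only [hG]
      rw [lintegral_finsetSum _ fun g _ => (measurable_deviation_MV b _).ennreal_ofReal]
      refine (Finset.sum_le_sum fun g hg => hKs (o := Fin.tail o) hy hm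
        (card_sortedGroup x hmd hS (Finset.mem_range.1 hg)) fun i hi k =>
          hν i (Finset.mem_filter.1 hi).1 k.succ).trans (le_of_eq ?_)
      rw [Finset.sum_const, Finset.card_range, nsmul_eq_mul,
        ENNReal.ofReal_mul (Nat.cast_nonneg m), ENNReal.ofReal_natCast]
    calc _ ≤ ∫⁻ x, (F x + ENNReal.ofReal (m * (K * m ^ d * (y / √m) ^ b)))
          ∂Measure.pi fun i => ν i 0 := lintegral_mono hinner
      _ = ∑ i ∈ S, ∫⁻ x, ENNReal.ofReal
            (|slotCenter m y (o 0) (rank S x i / m ^ d) - x i| ^ b) ∂(Measure.pi fun i => ν i 0) +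
          ENNReal.ofReal (m * (K * m ^ d * (y / √m) ^ b)) := by
        rw [lintegral_add_left hFm]
        simp only [lintegral_const, measure_univ, mul_one]
        rw [hF, lintegral_finsetSum _ fun i _ => measurable_slotCenter_deviation _ _ _ _ _ _ _]
      _ ≤ ∑ i ∈ S, ENNReal.ofReal (K' * (y / √m) ^ b) +
          ENNReal.ofReal (m * (K * m ^ d * (y / √m) ^ b)) := by
        gcongr with i hi
        exact hKs' hy hm hmd hS (fun j hj => hν j hj 0) i hi
      _ = _ := by
        rw [Finset.sum_const, nsmul_eq_mul, hS, ← ENNReal.ofReal_natCast,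
          ← ENNReal.ofReal_mul (by positivity), ← ENNReal.ofReal_add (by positivity)
            (by positivity)]
        congr 1
        push_cast
        ring

/-! ### The size of the parameters of `LV` -/

lemma pConst_eq (d : ℕ) (a : ℝ) : pConst d a = 3 * aConst d a := by
  unfold pConst aConst; ring

lemma le_pConst {a : ℝ} (d : ℕ) (ha : 0 < a) : 9 / 2 ≤ pConst d a := by
  have : 0 ≤ a / d := by positivity
  unfold pConst; linarith

lemma aConst_pos {a : ℝ} (d : ℕ) (ha : 0 < a) : 0 < aConst d a := by
  unfold aConst; positivity

/-- From `x₀` on, `x / (p ln x)` is at least `3`.  Moreover `x₀` is large enough for `A ln x₀ ≥ 3`,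
since the equation for `x₀` forces `x₀ ≥ 27 / 2 > e ^ 2`. -/
lemma log_bounds {d n : ℕ} {a x₀ : ℝ} (ha : 0 < a) (hx₀ : 3 ≤ x₀)
    (hx₀' : x₀ / (pConst d a * Real.log x₀) = 3) (hn : ⌈x₀⌉₊ ≤ n) :
    1 ≤ Real.log n ∧ 3 ≤ n / (pConst d a * Real.log n) ∧ 3 ≤ aConst d a * Real.log n := by
  have hp := le_pConst d ha
  have hp0 : 0 < pConst d a := by linarith
  have he := Real.exp_one_lt_d9
  have hxn : x₀ ≤ n := Nat.ceil_le.1 hn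
  have hlx : 1 ≤ Real.log x₀ := (Real.le_log_iff_exp_le (by linarith)).2 (by linarith)
  have hle : Real.log x₀ ≤ Real.log n := Real.log_le_log (by linarith) hxn
  have hx : x₀ = 3 * (pConst d a * Real.log x₀) := by
    rw [div_eq_iff (mul_pos hp0 (by linarith)).ne'] at hx₀'
    exact hx₀'
  have hl2 : 2 ≤ Real.log x₀ := by
    rw [Real.le_log_iff_exp_le (by linarith)]
    have : Real.exp 2 = Real.exp 1 * Real.exp 1 := by rw [← Real.exp_add]; norm_num
    nlinarith [Real.exp_pos 1]
  refine ⟨hlx.trans hle, ?_, ?_⟩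
  · have hanti := Real.log_div_self_antitoneOn (a := x₀) (b := n)
      (Set.mem_Ici.2 (by linarith)) (Set.mem_Ici.2 (by linarith)) hxn
    simp only at hanti
    rw [div_le_div_iff₀ (by linarith) (by linarith)] at hanti
    rw [le_div_iff₀ (mul_pos hp0 (by linarith))]
    have h0 : 0 < Real.log x₀ := by linarith
    have h1 : Real.log n * (3 * pConst d a) * Real.log x₀ ≤ n * Real.log x₀ := by
      calc _ = Real.log n * x₀ := by nth_rewrite 2 [hx]; ring
        _ ≤ Real.log x₀ * n := hanti
        _ = _ := by ring
    have := le_of_mul_le_mul_right h1 h0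
    linarith
  · have := pConst_eq d a
    nlinarith

lemma floor_ge_mul {T u : ℝ} (hT : 1 < T) (hu : T ≤ u) : u * ((T - 1) / T) ≤ ⌊u⌋₊ := by
  have h := Nat.sub_one_lt_floor u
  have h1 : u * ((T - 1) / T) = u - u / T := by field_simp
  have h2 : 1 ≤ u / T := (one_le_div (by linarith)).2 hu
  linarith

lemma one_lt_three_rpow {d : ℕ} (hd : 0 < d) : 1 < (3 : ℝ) ^ (1 / (d : ℝ)) :=
  Real.one_lt_rpow (by norm_num) (by positivity)

lemma rpow_one_div_pow {d : ℕ} (hd : 0 < d) {x : ℝ} (hx : 0 ≤ x) : (x ^ (1 / (d : ℝ))) ^ d = x := by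
  rw [one_div]; exact Real.rpow_inv_natCast_pow hx hd.ne'

/-- The ratio `(T - 1) / T` with `T = 3 ^ (1/d)`, which bounds the relative loss in the roundings. -/
noncomputable def roundingRatio (d : ℕ) : ℝ :=
  ((3 : ℝ) ^ (1 / (d : ℝ)) - 1) / (3 : ℝ) ^ (1 / (d : ℝ))

lemma roundingRatio_pos {d : ℕ} (hd : 0 < d) : 0 < roundingRatio d := by
  have := one_lt_three_rpow hd
  exact div_pos (by linarith) (by linarith)

lemma roundingRatio_le_one {d : ℕ} (hd : 0 < d) : roundingRatio d ≤ 1 := by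
  have := one_lt_three_rpow hd
  exact (div_le_one (by linarith)).2 (by linarith)

/-- Rounding a `d`-th root of a number `z ≥ 3` down loses at most a constant factor. -/
lemma floor_rpow_bounds {d : ℕ} (hd : 0 < d) {z : ℝ} (hz : 3 ≤ z) :
    0 < ⌊z ^ (1 / (d : ℝ))⌋₊ ∧ z ^ (1 / (d : ℝ)) * roundingRatio d ≤ ⌊z ^ (1 / (d : ℝ))⌋₊ ∧
      (⌊z ^ (1 / (d : ℝ))⌋₊ : ℝ) ≤ z ^ (1 / (d : ℝ)) ∧ (⌊z ^ (1 / (d : ℝ))⌋₊ : ℝ) ^ d ≤ z := by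
  have hT := one_lt_three_rpow hd
  have hu : (3 : ℝ) ^ (1 / (d : ℝ)) ≤ z ^ (1 / (d : ℝ)) := by gcongr
  have h3 : (⌊z ^ (1 / (d : ℝ))⌋₊ : ℝ) ≤ z ^ (1 / (d : ℝ)) := Nat.floor_le (by positivity)
  refine ⟨Nat.floor_pos.2 (by linarith), floor_ge_mul hT hu, h3, ?_⟩
  calc (⌊z ^ (1 / (d : ℝ))⌋₊ : ℝ) ^ d ≤ (z ^ (1 / (d : ℝ))) ^ d := by gcongr
    _ = z := rpow_one_div_pow hd (by linarith)

lemma roundingRatio_radius {d : ℕ} (hd : 0 < d) {f : ℝ}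
    (hf : (3 : ℝ) ^ (3 / (d : ℝ)) /
        (((3 : ℝ) ^ (1 / (d : ℝ)) - 1) * ((3 : ℝ) ^ (1 / (d : ℝ)) - 1)) ≤ f) :
    1 ≤ f * roundingRatio d ∧ (3 : ℝ) ^ (1 / (d : ℝ)) ≤ f * roundingRatio d ^ 2 := by
  have hT := one_lt_three_rpow hd
  have h3 : (3 : ℝ) ^ (3 / (d : ℝ)) = ((3 : ℝ) ^ (1 / (d : ℝ))) ^ 3 := by
    rw [← Real.rpow_natCast, ← Real.rpow_mul (by norm_num)]
    congr 1; push_cast; ring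
  rw [h3] at hf
  have hr0 := roundingRatio_pos hd
  have hr1 := roundingRatio_le_one hd
  unfold roundingRatio at *
  set T := (3 : ℝ) ^ (1 / (d : ℝ))
  have hT1 : 0 < T - 1 := by linarith
  have key : T ≤ f * ((T - 1) / T) ^ 2 := by
    calc T = T ^ 3 / ((T - 1) * (T - 1)) * ((T - 1) / T) ^ 2 := by field_simp
      _ ≤ _ := by gcongr
  refine ⟨?_, key⟩
  have hf0 : 0 ≤ f := le_trans (by positivity) hf
  nlinarith [mul_nonneg hf0 hr0.le]

lemma rpow_mul_rpow_edge {d n : ℕ} {a : ℝ} (ha : 0 < a) (hl : 1 ≤ Real.log n) :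
    ((n : ℝ) / (pConst d a * Real.log n)) ^ (1 / (d : ℝ)) *
      (aConst d a * Real.log n) ^ (1 / (d : ℝ)) * (3 : ℝ) ^ (1 / (d : ℝ)) =
        (n : ℝ) ^ (1 / (d : ℝ)) := by
  have hA := aConst_pos d ha
  rw [pConst_eq, ← Real.mul_rpow (by positivity) (by positivity),
    ← Real.mul_rpow (by positivity) (by norm_num)]
  congr 1
  field_simp

/-! ### The subcubes -/

lemma cellIndex_lt {d q : ℕ} (hq : 0 < q) (x : Fin d → ℝ) (k : Fin d) : cellIndex q x k < q := by
  unfold cellIndex; omega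

lemma cell_bounds {q : ℕ} (hq : 0 < q) {t : ℝ} (ht : t ∈ Set.Icc (0 : ℝ) 1) :
    ((min ⌊(q : ℝ) * t⌋₊ (q - 1) : ℕ) : ℝ) / q ≤ t ∧
      t ≤ ((min ⌊(q : ℝ) * t⌋₊ (q - 1) : ℕ) : ℝ) / q + 1 / q := by
  have hq' : (0 : ℝ) < q := by exact_mod_cast hq
  have h0 : 0 ≤ (q : ℝ) * t := mul_nonneg hq'.le ht.1
  rw [← add_div, div_le_iff₀ hq', le_div_iff₀ hq']
  constructor
  · have : ((min ⌊(q : ℝ) * t⌋₊ (q - 1) : ℕ) : ℝ) ≤ ⌊(q : ℝ) * t⌋₊ :=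
      Nat.cast_le.2 (min_le_left _ _)
    linarith [Nat.floor_le h0]
  · rcases min_choice ⌊(q : ℝ) * t⌋₊ (q - 1) with h | h
    · rw [h]; linarith [Nat.lt_floor_add_one ((q : ℝ) * t)]
    · rw [h, Nat.cast_sub hq]; push_cast; nlinarith [ht.2]

lemma cellIndex_bounds {d q : ℕ} (hq : 0 < q) {x : Fin d → ℝ} (hx : x ∈ Set.Icc (0 : Fin d → ℝ) 1)
    (k : Fin d) : (cellIndex q x k : ℝ) / q ≤ x k ∧ x k ≤ (cellIndex q x k : ℝ) / q + 1 / q :=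
  cell_bounds hq ⟨hx.1 k, hx.2 k⟩

lemma mem_occupants {n d q : ℕ} {X : Fin n → Fin d → ℝ} {c : Fin d → ℕ} {i : Fin n} :
    i ∈ occupants q X c ↔ cellIndex q (X i) = c := by
  simp [occupants]

/-! ### The algorithm `LV` is well defined and attains coverage -/

section
variable {n d : ℕ} {a : ℝ} {X : Fin n → Fin d → ℝ} {S : Finset (Fin n)}

lemma LV_of_underpopulated (h : Underpopulated a X) :
    LV a X S = MV d (edgeAll d n) 1 0 S X := if_pos h

lemma LV_of_not_underpopulated (h : ¬ Underpopulated a X) (i : Fin n) :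
    LV a X S i = MV d (edgeChosen d a n) (1 / edgeCells d a n)
      (fun k => (cellIndex (edgeCells d a n) (X i) k : ℝ) / edgeCells d a n)
      (S ∩ occupants (edgeCells d a n) X (cellIndex (edgeCells d a n) (X i))) X i := by
  rw [LV, if_neg h]

lemma mem_lvChoices_of_underpopulated (h : Underpopulated a X) :
    S ∈ lvChoices a X ↔ S.card = edgeAll d n ^ d := by
  simp [lvChoices, h, Finset.mem_powersetCard]

lemma mem_lvChoices_of_not_underpopulated (h : ¬ Underpopulated a X) :
    S ∈ lvChoices a X ↔ ∀ c : Fin d → Fin (edgeCells d a n),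
      (S ∩ occupants (edgeCells d a n) X fun k => (c k : ℕ)).card = edgeChosen d a n ^ d := by
  simp [lvChoices, h]

lemma edgeChosen_pow_le (hd : 0 < d) (ha : 0 < a) (hl : 1 ≤ Real.log n)
    (h1 : 3 ≤ n / (pConst d a * Real.log n)) (h2 : 3 ≤ aConst d a * Real.log n) :
    (edgeChosen d a n : ℝ) ^ d ≤ 1 / 3 * (n / (edgeCells d a n : ℝ) ^ d) := by
  obtain ⟨hq0, -, -, hq⟩ := floor_rpow_bounds hd h1
  obtain ⟨-, -, -, hm⟩ := floor_rpow_bounds hd h2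
  have hq0' : (0 : ℝ) < ⌊(n / (pConst d a * Real.log n)) ^ (1 / (d : ℝ))⌋₊ := by
    exact_mod_cast hq0
  have hA := aConst_pos d ha
  unfold edgeChosen edgeCells
  refine hm.trans ?_
  rw [← mul_div_assoc, le_div_iff₀ (by positivity)]
  calc _ ≤ aConst d a * Real.log n * (n / (pConst d a * Real.log n)) := by gcongr
    _ = 1 / 3 * n := by rw [pConst_eq]; field_simp

lemma lvChoices_nonempty (hd : 0 < d) (ha : 0 < a) (hl : 1 ≤ Real.log n)
    (h1 : 3 ≤ n / (pConst d a * Real.log n)) (h2 : 3 ≤ aConst d a * Real.log n) :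
    (lvChoices a X).Nonempty := by
  classical
  by_cases h : Underpopulated a X
  · have hle : edgeAll d n ^ d ≤ (Finset.univ : Finset (Fin n)).card := by
      rw [Finset.card_fin]
      have : (edgeAll d n : ℝ) ^ d ≤ n := by
        calc (edgeAll d n : ℝ) ^ d ≤ ((n : ℝ) ^ (1 / (d : ℝ))) ^ d := by
              gcongr; exact Nat.floor_le (by positivity)
          _ = n := rpow_one_div_pow hd (by positivity)
      exact_mod_cast this
    obtain ⟨S, -, hS⟩ := Finset.exists_subset_card_eq hle
    exact ⟨S, (mem_lvChoices_of_underpopulated h).2 hS⟩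
  · set q := edgeCells d a n with hq
    have hle : ∀ c : Fin d → Fin q, edgeChosen d a n ^ d ≤
        (occupants q X fun k => (c k : ℕ)).card := by
      intro c
      have h3 : ¬ _ := fun h' => h ⟨c, h'⟩
      have h4 := (edgeChosen_pow_le hd ha hl h1 h2).trans (not_lt.1 h3)
      exact_mod_cast h4
    choose T hT hTc using fun c => Finset.exists_subset_card_eq (hle c)
    refine ⟨Finset.univ.biUnion T, (mem_lvChoices_of_not_underpopulated h).2 fun c => ?_⟩
    rw [← hTc c]
    congr 1
    ext i
    simp only [Finset.mem_inter, Finset.mem_biUnion, Finset.mem_univ, true_and]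
    constructor
    · rintro ⟨⟨c', hc'⟩, hi⟩
      have h5 := mem_occupants.1 (hT c' hc')
      have h6 := mem_occupants.1 hi
      have : c' = c := by
        funext k
        exact Fin.ext (congrFun (h5.symm.trans h6) k)
      exact this ▸ hc'
    · exact fun hi => ⟨⟨c, hi⟩, hT c hi⟩

lemma LV_covers (hd : 0 < d) (ha : 0 < a) (hl : 1 ≤ Real.log n) (hn : 3 ≤ (n : ℝ))
    (h1 : 3 ≤ n / (pConst d a * Real.log n)) (h2 : 3 ≤ aConst d a * Real.log n) {f : ℝ}
    (hf : (3 : ℝ) ^ (3 / (d : ℝ)) /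
        (((3 : ℝ) ^ (1 / (d : ℝ)) - 1) * ((3 : ℝ) ^ (1 / (d : ℝ)) - 1)) ≤ f)
    (hS : S ∈ lvChoices a X) : Covers (f / (2 * (n : ℝ) ^ (1 / (d : ℝ)))) (LV a X S) := by
  intro x hx
  obtain ⟨hf1, hf2⟩ := roundingRatio_radius hd hf
  have hr0 := roundingRatio_pos hd
  have hf0 : 0 < f := by
    by_contra hcon
    nlinarith [mul_nonneg (neg_nonneg.2 (not_lt.1 hcon)) hr0.le]
  have hv : 0 < (n : ℝ) ^ (1 / (d : ℝ)) := by positivity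
  by_cases h : Underpopulated a X
  · rw [mem_lvChoices_of_underpopulated h] at hS
    rw [LV_of_underpopulated h]
    obtain ⟨hm0, hm1, -, -⟩ := floor_rpow_bounds hd hn
    change 0 < edgeAll d n at hm0
    change _ ≤ (edgeAll d n : ℝ) at hm1
    have hm0' : (0 : ℝ) < edgeAll d n := by exact_mod_cast hm0
    obtain ⟨i, -, hi⟩ := MV_covers hm0 one_pos (o := 0) hS X (x := x)
      (fun k => ⟨hx.1 k, by simpa using hx.2 k⟩)
    refine ⟨i, fun k => (hi k).trans ?_⟩
    rw [div_le_div_iff₀ (by positivity) (by positivity)]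
    have : (n : ℝ) ^ (1 / (d : ℝ)) ≤ f * edgeAll d n := by
      calc (n : ℝ) ^ (1 / (d : ℝ)) ≤ (n : ℝ) ^ (1 / (d : ℝ)) * (f * roundingRatio d) :=
            le_mul_of_one_le_right hv.le hf1
        _ = f * ((n : ℝ) ^ (1 / (d : ℝ)) * roundingRatio d) := by ring
        _ ≤ _ := by gcongr
    linarith
  · rw [mem_lvChoices_of_not_underpopulated h] at hS
    obtain ⟨hq0, hq1, -, -⟩ := floor_rpow_bounds hd h1
    change 0 < edgeCells d a n at hq0
    change _ ≤ (edgeCells d a n : ℝ) at hq1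
    obtain ⟨hm0, hm1, -, -⟩ := floor_rpow_bounds hd h2
    change 0 < edgeChosen d a n at hm0
    change _ ≤ (edgeChosen d a n : ℝ) at hm1
    set q := edgeCells d a n with hq
    set m := edgeChosen d a n with hm
    have hq0' : (0 : ℝ) < q := by exact_mod_cast hq0
    have hm0' : (0 : ℝ) < m := by exact_mod_cast hm0
    have hSc := hS fun k => ⟨cellIndex q x k, cellIndex_lt hq0 x k⟩
    obtain ⟨i, hi, hik⟩ := MV_covers hm0 (show 0 < 1 / (q : ℝ) by positivity)
      (o := fun k => (cellIndex q x k : ℝ) / q) hSc X (cellIndex_bounds hq0 hx)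
    have hic : cellIndex q (X i) = cellIndex q x := mem_occupants.1 (Finset.mem_inter.1 hi).2
    refine ⟨i, fun k => ?_⟩
    rw [LV_of_not_underpopulated h, ← hq, ← hm, hic]
    refine (hik k).trans ?_
    rw [div_div, div_le_div_iff₀ (by positivity) (by positivity)]
    have : (n : ℝ) ^ (1 / (d : ℝ)) ≤ f * (q * m) := by
      have hT := one_lt_three_rpow hd
      rw [← rpow_mul_rpow_edge ha hl]
      calc _ ≤ ((n : ℝ) / (pConst d a * Real.log n)) ^ (1 / (d : ℝ)) *
            (aConst d a * Real.log n) ^ (1 / (d : ℝ)) * (f * roundingRatio d ^ 2) := by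
            gcongr
        _ = f * ((((n : ℝ) / (pConst d a * Real.log n)) ^ (1 / (d : ℝ)) * roundingRatio d) *
            ((aConst d a * Real.log n) ^ (1 / (d : ℝ)) * roundingRatio d)) := by ring
        _ ≤ f * (q * m) := by gcongr
    linarith
end

/-! ### The law of the sensors, given their subcubes -/

lemma measurable_cellIndex {d : ℕ} (q : ℕ) : Measurable (cellIndex (d := d) q) := by
  unfold cellIndex
  refine measurable_pi_iff.2 fun k => ?_
  have h1 : Measurable fun r : ℕ => min r (q - 1) := measurable_from_nat
  exact h1.comp (Nat.measurable_floor.comp ((measurable_pi_apply k).const_mul _))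

lemma restrict_unitInterval_cell {q j : ℕ} (hj : j < q) :
    ((volume : Measure ℝ).restrict (Set.Icc 0 1)).restrict {t | min ⌊(q : ℝ) * t⌋₊ (q - 1) = j} =
      ENNReal.ofReal (1 / q) • unif ((j : ℝ) / q) (1 / q) := by
  have hq : 0 < q := by omega
  have hq' : (0 : ℝ) < q := by exact_mod_cast hq
  have hm : MeasurableSet {t : ℝ | min ⌊(q : ℝ) * t⌋₊ (q - 1) = j} := by
    have h1 : Measurable fun r : ℕ => min r (q - 1) := measurable_from_nat
    have h2 : Measurable fun t : ℝ => min ⌊(q : ℝ) * t⌋₊ (q - 1) :=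
      h1.comp (Nat.measurable_floor.comp (measurable_id.const_mul _))
    exact h2 (measurableSet_singleton j)
  rw [unif, smul_smul, ENNReal.mul_inv_cancel (by simpa using hq.ne') ENNReal.ofReal_ne_top,
    one_smul,
    Measure.restrict_restrict hm]
  apply Measure.restrict_congr_set
  apply Filter.EventuallyLE.antisymm
  · apply Filter.Eventually.of_forall
    rintro t ⟨rfl, ht⟩
    exact cell_bounds hq ht
  · refine (Ico_ae_eq_Icc (μ := volume)).symm.le.trans (Filter.Eventually.of_forall ?_)
    rintro t ⟨h0, h1⟩
    rw [← add_div, lt_div_iff₀ hq'] at h1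
    have hj0 : (0 : ℝ) ≤ (j : ℝ) / q := by positivity
    rw [div_le_iff₀ hq'] at h0
    have hjq : (j : ℝ) + 1 ≤ q := by exact_mod_cast hj
    have ht0 : 0 ≤ t := by nlinarith [(Nat.cast_nonneg j : (0 : ℝ) ≤ j)]
    refine ⟨?_, ht0, by nlinarith⟩
    have hf : ⌊(q : ℝ) * t⌋₊ = j :=
      (Nat.floor_eq_iff (by positivity)).2 ⟨by linarith, by linarith⟩
    change min _ _ = j
    rw [hf]; omega

lemma volume_restrict_Icc_eq_pi (d : ℕ) :
    (volume : Measure (Fin d → ℝ)).restrict (Set.Icc 0 1) =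
      Measure.pi fun _ => (volume : Measure ℝ).restrict (Set.Icc 0 1) := by
  rw [volume_pi, ← Set.pi_univ_Icc, Measure.restrict_pi_pi]
  rfl

instance isProbabilityMeasure_unitInterval :
    IsProbabilityMeasure ((volume : Measure ℝ).restrict (Set.Icc 0 1)) := ⟨by simp⟩

instance isProbabilityMeasure_unitCube (d : ℕ) :
    IsProbabilityMeasure ((volume : Measure (Fin d → ℝ)).restrict (Set.Icc 0 1)) := by
  rw [volume_restrict_Icc_eq_pi]; infer_instance

lemma unif_zero_one : unif 0 1 = (volume : Measure ℝ).restrict (Set.Icc 0 1) := by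
  simp [unif]

lemma restrict_unitCube_cell {d q : ℕ} (c : Fin d → Fin q) :
    ((volume : Measure (Fin d → ℝ)).restrict (Set.Icc 0 1)).restrict
        {x | cellIndex q x = fun k => (c k : ℕ)} =
      ENNReal.ofReal (1 / q) ^ d • Measure.pi fun k => unif ((c k : ℝ) / q) (1 / q) := by
  have hset : {x : Fin d → ℝ | cellIndex q x = fun k => (c k : ℕ)} =
      Set.univ.pi fun k => {t : ℝ | min ⌊(q : ℝ) * t⌋₊ (q - 1) = c k} := by
    ext x
    simp [cellIndex, funext_iff]
  rw [volume_restrict_Icc_eq_pi, hset, Measure.restrict_pi_pi]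
  simp only [restrict_unitInterval_cell (Fin.is_lt _)]
  have : ∀ k, IsFiniteMeasure (unif ((c k : ℝ) / q) (1 / q)) := fun k =>
    have := isProbabilityMeasure_unif ((c k : ℝ) / q) (y := 1 / q)
      (by have : 0 < q := (Nat.zero_le _).trans_lt (c k).is_lt
          positivity)
    inferInstance
  rw [pi_smul_measure _ ENNReal.ofReal_ne_top, Fintype.card_fin]

/-- The law of independent sensors, where the sensor `i` is uniformly distributed in the subcube with
index `σ i`. -/
noncomputable def cellsLaw {n d q : ℕ} (σ : Fin n → Fin d → Fin q) : Measure (Fin n → Fin d → ℝ) :=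
  Measure.pi fun i => Measure.pi fun k => unif ((σ i k : ℝ) / q) (1 / q)

lemma isProbabilityMeasure_cell {n d q : ℕ} (hq : 0 < q) (σ : Fin n → Fin d → Fin q) (i : Fin n)
    (k : Fin d) : IsProbabilityMeasure (unif ((σ i k : ℝ) / q) (1 / q)) :=
  isProbabilityMeasure_unif _ (by positivity)

lemma measurableSet_cells {n d q : ℕ} (σ : Fin n → Fin d → Fin q) :
    MeasurableSet {X : Fin n → Fin d → ℝ | ∀ i, cellIndex q (X i) = fun k => (σ i k : ℕ)} := by
  rw [Set.ofPred_forall]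
  refine MeasurableSet.iInter fun i => ?_
  exact ((measurable_cellIndex q).comp (measurable_pi_apply i)) (measurableSet_singleton _)

lemma sensorLaw_restrict_cells {n d q : ℕ} (hq : 0 < q) (σ : Fin n → Fin d → Fin q) :
    (sensorLaw n d).restrict {X | ∀ i, cellIndex q (X i) = fun k => (σ i k : ℕ)} =
      (ENNReal.ofReal (1 / q) ^ d) ^ n • cellsLaw σ := by
  have hset : {X : Fin n → Fin d → ℝ | ∀ i, cellIndex q (X i) = fun k => (σ i k : ℕ)} =
      Set.univ.pi fun i => {x | cellIndex q x = fun k => (σ i k : ℕ)} := by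
    ext X; simp
  have := isProbabilityMeasure_cell hq σ
  rw [sensorLaw, hset, Measure.restrict_pi_pi]
  simp only [restrict_unitCube_cell]
  rw [pi_smul_measure _ (ENNReal.pow_ne_top ENNReal.ofReal_ne_top), Fintype.card_fin, cellsLaw]

lemma ae_cellsLaw {n d q : ℕ} (hq : 0 < q) (σ : Fin n → Fin d → Fin q) :
    ∀ᵐ X ∂cellsLaw σ, ∀ i, cellIndex q (X i) = fun k => (σ i k : ℕ) := by
  have h := ae_restrict_mem (μ := sensorLaw n d) (measurableSet_cells σ)
  rw [sensorLaw_restrict_cells hq] at h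
  refine (Measure.ae_ennreal_smul_measure_iff ?_).1 h
  have hw : 0 < ENNReal.ofReal (1 / q) := by simpa using hq
  exact (ENNReal.pow_pos (ENNReal.pow_pos hw d) n).ne'

/-- A bound for the expectation of `F` that holds given the subcubes of all sensors holds
unconditionally. -/
lemma lintegral_sensorLaw_le_of_cells {n d q : ℕ} (hq : 0 < q) {F : (Fin n → Fin d → ℝ) → ENNReal}
    {c : ENNReal} (h : ∀ σ : Fin n → Fin d → Fin q, ∫⁻ X, F X ∂cellsLaw σ ≤ c) :
    ∫⁻ X, F X ∂sensorLaw n d ≤ c := by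
  have huniv : (Set.univ : Set (Fin n → Fin d → ℝ)) = ⋃ σ : Fin n → Fin d → Fin q,
      {X | ∀ i, cellIndex q (X i) = fun k => (σ i k : ℕ)} := by
    refine (Set.eq_univ_of_forall fun X => ?_).symm
    rw [Set.mem_iUnion]
    refine ⟨fun i k => ⟨cellIndex q (X i) k, cellIndex_lt hq _ _⟩, ?_⟩
    intro i
    rfl
  have hdisj : Pairwise (Function.onFun Disjoint fun σ : Fin n → Fin d → Fin q =>
      {X : Fin n → Fin d → ℝ | ∀ i, cellIndex q (X i) = fun k => (σ i k : ℕ)}) := by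
    intro σ τ hστ
    refine Set.disjoint_left.2 fun X hX hX' => hστ ?_
    funext i k
    exact Fin.ext (congrFun ((hX i).symm.trans (hX' i)) k)
  rw [← setLIntegral_univ, huniv, lintegral_iUnion measurableSet_cells hdisj, tsum_fintype]
  simp only [sensorLaw_restrict_cells hq, lintegral_smul_measure, smul_eq_mul]
  calc _ ≤ ∑ _σ : Fin n → Fin d → Fin q, (ENNReal.ofReal (1 / q) ^ d) ^ n * c := by
        gcongr with σ; exact h σ
    _ = c := by
      have hq' : (0 : ℝ) < q := by exact_mod_cast hq
      rw [Finset.sum_const, Finset.card_univ, Fintype.card_fun, Fintype.card_fun, Fintype.card_fin,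
        Fintype.card_fin, Fintype.card_fin, nsmul_eq_mul, ← mul_assoc]
      push_cast
      rw [← mul_pow, ← mul_pow, ← ENNReal.ofReal_natCast, ← ENNReal.ofReal_mul hq'.le,
        mul_one_div_cancel hq'.ne']
      simp

/-! ### The probability of the fallback case -/

lemma card_occupants_eq_sum {n d q : ℕ} (X : Fin n → Fin d → ℝ) (c : Fin d → ℕ) :
    ((occupants q X c).card : ℝ) =
      ∑ i, {x | cellIndex q x = c}.indicator (fun _ => (1 : ℝ)) (X i) := by
  classical
  rw [occupants, Finset.card_filter]
  push_cast
  refine Finset.sum_congr rfl fun i _ => ?_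
  simp [Set.indicator_apply]

lemma lintegral_exp_neg_cell_le {d q : ℕ} (c : Fin d → Fin q) :
    ∫⁻ x, ENNReal.ofReal (Real.exp (-{x | cellIndex q x = fun k => (c k : ℕ)}.indicator
        (fun _ => (1 : ℝ)) x)) ∂(volume : Measure (Fin d → ℝ)).restrict (Set.Icc 0 1) ≤
      ENNReal.ofReal (Real.exp (-((1 - Real.exp (-1)) * (1 / (q : ℝ) ^ d)))) := by
  classical
  set μ := (volume : Measure (Fin d → ℝ)).restrict (Set.Icc 0 1) with hμ
  set A : Set (Fin d → ℝ) := {x | cellIndex q x = fun k => (c k : ℕ)} with hA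
  have hAm : MeasurableSet A := measurable_cellIndex q (measurableSet_singleton _)
  have hpos : ∀ k, 0 < 1 / (q : ℝ) := fun k : Fin d => by
    have : 0 < q := (Nat.zero_le _).trans_lt (c k).is_lt
    positivity
  have h1 : μ A = ENNReal.ofReal (1 / (q : ℝ) ^ d) := by
    have := fun k => isProbabilityMeasure_unif ((c k : ℝ) / q) (hpos k)
    have h2 := congrArg (fun ν => ν Set.univ) (restrict_unitCube_cell c)
    simp only [Measure.restrict_apply_univ, Measure.smul_apply, measure_univ, smul_eq_mul,
      mul_one] at h2
    rw [h2, ← ENNReal.ofReal_pow (by positivity), one_div_pow]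
  have h2 : μ Aᶜ = ENNReal.ofReal (1 - 1 / (q : ℝ) ^ d) := by
    rw [prob_compl_eq_one_sub hAm, h1, ENNReal.ofReal_sub _ (by positivity), ENNReal.ofReal_one]
  have h3 : 1 / (q : ℝ) ^ d ≤ 1 := by
    have : μ A ≤ 1 := prob_le_one
    rw [h1] at this
    simpa using this
  rw [← lintegral_add_compl _ hAm]
  rw [setLIntegral_congr_fun (g := fun _ => ENNReal.ofReal (Real.exp (-1))) hAm
      (fun s hs => by simp only [Set.indicator_of_mem hs]),
    setLIntegral_congr_fun (g := fun _ => 1) hAm.compl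
      (fun s hs => by simp [Set.indicator_of_notMem hs]),
    setLIntegral_const, setLIntegral_const, h1, h2, one_mul, ← ENNReal.ofReal_mul (by positivity),
    ← ENNReal.ofReal_add (by positivity) (by linarith)]
  apply ENNReal.ofReal_le_ofReal
  have := Real.add_one_le_exp (-((1 - Real.exp (-1)) * (1 / (q : ℝ) ^ d)))
  linarith

lemma exp_neg_one_le : Real.exp (-1) ≤ 7 / 18 := by
  rw [Real.exp_neg, inv_le_comm₀ (Real.exp_pos _) (by norm_num)]
  linarith [Real.exp_one_gt_d9]

lemma measurable_card_occupants {n d q : ℕ} (c : Fin d → ℕ) :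
    Measurable fun X : Fin n → Fin d → ℝ => ((occupants q X c).card : ℝ) := by
  simp only [card_occupants_eq_sum]
  refine Finset.measurable_sum _ fun i _ => ?_
  exact (measurable_const.indicator (measurable_cellIndex q (measurableSet_singleton c))).comp
    (measurable_pi_apply i)

/-- The Chernoff bound for the number of sensors in a subcube, with mean `μ = n / q ^ d`.  The
exponential moment with parameter `-1` suffices: it yields the rate `1 - e⁻¹ - 1/3 ≥ 5/18`. -/
lemma sensorLaw_occupants_lt_le {n d q : ℕ} (c : Fin d → Fin q) :
    sensorLaw n d {X | ((occupants q X fun k => (c k : ℕ)).card : ℝ) < 1 / 3 * (n / (q : ℝ) ^ d)} ≤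
      ENNReal.ofReal (Real.exp (-(5 / 18 * (n / (q : ℝ) ^ d)))) := by
  set μ : ℝ := n / (q : ℝ) ^ d with hμ
  have hμ0 : 0 ≤ μ := by positivity
  have hmeas : MeasurableSet
      {X : Fin n → Fin d → ℝ | ((occupants q X fun k => (c k : ℕ)).card : ℝ) < 1 / 3 * μ} :=
    measurableSet_lt (measurable_card_occupants _) measurable_const
  rw [← lintegral_indicator_one hmeas]
  set g : (Fin d → ℝ) → ENNReal := fun x => ENNReal.ofReal (Real.exp (-{x | cellIndex q x =
    fun k => (c k : ℕ)}.indicator (fun _ => (1 : ℝ)) x)) with hg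
  have hgm : Measurable g := by
    refine ENNReal.measurable_ofReal.comp (Real.measurable_exp.comp (Measurable.neg ?_))
    exact measurable_const.indicator (measurable_cellIndex q (measurableSet_singleton _))
  have hpt : ∀ X : Fin n → Fin d → ℝ,
      {X : Fin n → Fin d → ℝ | ((occupants q X fun k => (c k : ℕ)).card : ℝ) < 1 / 3 * μ}.indicator
        1 X ≤ ENNReal.ofReal (Real.exp (1 / 3 * μ)) * ∏ i, g (X i) := by
    intro X
    have e : ∏ i, g (X i) =
        ENNReal.ofReal (Real.exp (-((occupants q X fun k => (c k : ℕ)).card : ℝ))) := by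
      rw [card_occupants_eq_sum, ← Finset.sum_neg_distrib, Real.exp_sum,
        ENNReal.ofReal_prod_of_nonneg (fun _ _ => (Real.exp_pos _).le)]
    rw [e, ← ENNReal.ofReal_mul (by positivity), ← Real.exp_add]
    refine Set.indicator_le (g := fun X : Fin n → Fin d → ℝ => ENNReal.ofReal (Real.exp
      (1 / 3 * μ + -((occupants q X fun k => (c k : ℕ)).card : ℝ)))) (fun Y hY => ?_) X
    change 1 ≤ _
    rw [← ENNReal.ofReal_one]
    apply ENNReal.ofReal_le_ofReal
    apply Real.one_le_exp
    have : ((occupants q Y fun k => (c k : ℕ)).card : ℝ) < 1 / 3 * μ := hY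
    linarith
  calc _ ≤ ∫⁻ X, ENNReal.ofReal (Real.exp (1 / 3 * μ)) * ∏ i, g (X i) ∂sensorLaw n d :=
        lintegral_mono hpt
    _ = ENNReal.ofReal (Real.exp (1 / 3 * μ)) *
        ∏ _i : Fin n, ∫⁻ x, g x ∂(volume : Measure (Fin d → ℝ)).restrict (Set.Icc 0 1) := by
      rw [lintegral_const_mul' _ _ ENNReal.ofReal_ne_top, sensorLaw,
        lintegral_pi_prod _ (f := fun _ => g) fun _ => hgm]
    _ ≤ ENNReal.ofReal (Real.exp (1 / 3 * μ)) * ∏ _i : Fin n,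
        ENNReal.ofReal (Real.exp (-((1 - Real.exp (-1)) * (1 / (q : ℝ) ^ d)))) := by
      gcongr
      exact lintegral_exp_neg_cell_le c
    _ = ENNReal.ofReal (Real.exp (1 / 3 * μ + n * -((1 - Real.exp (-1)) * (1 / (q : ℝ) ^ d)))) := by
      rw [Finset.prod_const, Finset.card_fin, ← ENNReal.ofReal_pow (Real.exp_pos _).le,
        ← Real.exp_nat_mul, ← ENNReal.ofReal_mul (by positivity), ← Real.exp_add]
    _ ≤ _ := by
      apply ENNReal.ofReal_le_ofReal
      apply Real.exp_le_exp.2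
      have e : n * -((1 - Real.exp (-1)) * (1 / (q : ℝ) ^ d)) = -(1 - Real.exp (-1)) * μ := by
        rw [hμ]; ring
      rw [e]
      nlinarith [exp_neg_one_le]

lemma measurableSet_underpopulated {n d : ℕ} (a : ℝ) :
    MeasurableSet {X : Fin n → Fin d → ℝ | Underpopulated a X} := by
  simp only [Underpopulated, Set.ofPred_exists]
  exact MeasurableSet.iUnion fun c =>
    measurableSet_lt (measurable_card_occupants _) measurable_const

lemma sensorLaw_underpopulated_le {n d : ℕ} {a : ℝ} (hd : 0 < d) (ha : 0 < a)
    (hl : 1 ≤ Real.log n) (h1 : 3 ≤ n / (pConst d a * Real.log n)) :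
    sensorLaw n d {X | Underpopulated a X} ≤ ENNReal.ofReal ((n : ℝ) ^ (-(5 / 8 * (a / d)))) := by
  have hp := le_pConst d ha
  have hp0 : 0 < pConst d a := by linarith
  obtain ⟨hq0, -, -, hq⟩ := floor_rpow_bounds hd h1
  change 0 < edgeCells d a n at hq0
  change (edgeCells d a n : ℝ) ^ d ≤ _ at hq
  set q := edgeCells d a n with hqdef
  have hq0' : (0 : ℝ) < q := by exact_mod_cast hq0
  have hn0 : (0 : ℝ) < n := by
    rcases Nat.eq_zero_or_pos n with h | h
    · rw [h] at hl; simp at hl; linarith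
    · exact_mod_cast h
  have hn1 : (1 : ℝ) ≤ n := by exact_mod_cast (Nat.cast_pos.1 hn0)
  have hμ : pConst d a * Real.log n ≤ n / (q : ℝ) ^ d := by
    rw [le_div_iff₀ (by positivity)]
    rw [le_div_iff₀ (by positivity)] at hq
    linarith
  have hqn : (q : ℝ) ^ d ≤ n := hq.trans (div_le_self hn0.le (by nlinarith))
  calc sensorLaw n d {X | Underpopulated a X}
      ≤ ∑ c : Fin d → Fin q, sensorLaw n d
        {X | ((occupants q X fun k => (c k : ℕ)).card : ℝ) < 1 / 3 * (n / (q : ℝ) ^ d)} := by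
        simp only [Underpopulated, Set.ofPred_exists]
        exact measure_iUnion_fintype_le _ _
    _ ≤ ∑ _c : Fin d → Fin q, ENNReal.ofReal (Real.exp (-(5 / 18 * (n / (q : ℝ) ^ d)))) :=
        Finset.sum_le_sum fun c _ => sensorLaw_occupants_lt_le c
    _ = ENNReal.ofReal ((q : ℝ) ^ d * Real.exp (-(5 / 18 * (n / (q : ℝ) ^ d)))) := by
        rw [Finset.sum_const, Finset.card_univ, Fintype.card_fun, Fintype.card_fin,
          Fintype.card_fin, nsmul_eq_mul, ENNReal.ofReal_mul (by positivity), ← Nat.cast_pow,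
          ENNReal.ofReal_natCast]
    _ ≤ _ := by
        apply ENNReal.ofReal_le_ofReal
        calc (q : ℝ) ^ d * Real.exp (-(5 / 18 * (n / (q : ℝ) ^ d)))
            ≤ n * Real.exp (-(5 / 18 * (pConst d a * Real.log n))) := by gcongr
          _ = (n : ℝ) ^ (1 - 5 / 18 * pConst d a) := by
              rw [sub_eq_add_neg, Real.rpow_add hn0, Real.rpow_one,
                Real.rpow_def_of_pos hn0 (-(5 / 18 * pConst d a))]
              congr 2; ring
          _ ≤ _ := by
              apply Real.rpow_le_rpow_of_exponent_le hn1
              -- `5/18 * p = 5/8 * (2 + a/d)`, of which `5/4 ≥ 1` pays for the union bound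
              unfold pConst
              linarith

/-! ### Comparison of the movement with the coordinatewise displacements -/

/-- The properties that the two notions of displacement share. -/
structure IsDisplacement {d : ℕ} (δ : (Fin d → ℝ) → (Fin d → ℝ) → ℝ) : Prop where
  nonneg : ∀ x z, 0 ≤ δ x z
  le_sum : ∀ x z, δ x z ≤ ∑ k, |z k - x k|
  measurable : Measurable fun p : (Fin d → ℝ) × (Fin d → ℝ) => δ p.1 p.2

lemma isDisplacement_euclidean (d : ℕ) : IsDisplacement (euclideanDisplacement (d := d)) where
  nonneg _ _ := Real.sqrt_nonneg _
  le_sum x z := by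
    refine Real.sqrt_le_iff.2 ⟨Finset.sum_nonneg fun _ _ => abs_nonneg _, ?_⟩
    have h := Finset.sum_sq_le_sq_sum_of_nonneg (s := Finset.univ) (f := fun k => |z k - x k|)
      fun _ _ => abs_nonneg _
    simpa only [sq_abs] using h
  measurable := by unfold euclideanDisplacement; fun_prop

lemma isDisplacement_distanceTravelled (d : ℕ) : IsDisplacement (distanceTravelled (d := d)) where
  nonneg _ _ := Finset.sum_nonneg fun _ _ => abs_nonneg _
  le_sum _ _ := le_rfl
  measurable := by unfold distanceTravelled; fun_prop

lemma sum_rpow_le {d : ℕ} {a : ℝ} (ha : 0 < a) (t : Fin d → ℝ) (ht : ∀ k, 0 ≤ t k) :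
    (∑ k, t k) ^ a ≤ (d : ℝ) ^ a * ∑ k, t k ^ a := by
  rcases isEmpty_or_nonempty (Fin d) with h | h
  · simp [Real.zero_rpow ha.ne']
  · obtain ⟨k₀, hk₀⟩ := Finite.exists_max t
    calc (∑ k, t k) ^ a ≤ (d * t k₀) ^ a := by
          refine Real.rpow_le_rpow (Finset.sum_nonneg fun k _ => ht k) ?_ ha.le
          simpa using Finset.sum_le_card_nsmul Finset.univ t (t k₀) fun k _ => hk₀ k
      _ = (d : ℝ) ^ a * t k₀ ^ a := Real.mul_rpow (by positivity) (ht k₀)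
      _ ≤ _ := by
          gcongr
          exact Finset.single_le_sum (f := fun k => t k ^ a)
            (fun k _ => Real.rpow_nonneg (ht k) a) (Finset.mem_univ k₀)

section
variable {n d : ℕ} {a : ℝ} {δ : (Fin d → ℝ) → (Fin d → ℝ) → ℝ}

lemma totalMovement_nonneg (hδ : IsDisplacement δ) (X Z : Fin n → Fin d → ℝ) :
    0 ≤ totalMovement δ a X Z :=
  Finset.sum_nonneg fun _ _ => Real.rpow_nonneg (hδ.nonneg _ _) _

lemma totalMovement_le_deviation (hδ : IsDisplacement δ) (ha : 0 < a) {S : Finset (Fin n)}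
    {X Z : Fin n → Fin d → ℝ} (hZ : ∀ i ∉ S, Z i = X i) :
    totalMovement δ a X Z ≤ (d : ℝ) ^ a * deviation a S X Z := by
  have h0 : totalMovement δ a X Z = ∑ i ∈ S, δ (X i) (Z i) ^ a := by
    refine (Finset.sum_subset (Finset.subset_univ S) fun i _ hi => ?_).symm
    have h1 : δ (X i) (Z i) = 0 := by
      refine le_antisymm ((hδ.le_sum _ _).trans ?_) (hδ.nonneg _ _)
      simp [hZ i hi]
    rw [h1, Real.zero_rpow ha.ne']
  rw [h0, deviation, Finset.mul_sum]
  refine Finset.sum_le_sum fun i _ => ?_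
  exact (Real.rpow_le_rpow (hδ.nonneg _ _) (hδ.le_sum _ _) ha.le).trans
    (sum_rpow_le ha _ fun k => abs_nonneg _)

lemma measurable_totalMovement (hδ : IsDisplacement δ)
    {Z : (Fin n → Fin d → ℝ) → Fin n → Fin d → ℝ}
    (hZ : ∀ i, Measurable fun X => Z X i) : Measurable fun X => totalMovement δ a X (Z X) := by
  unfold totalMovement
  refine Finset.measurable_sum _ fun i _ => Measurable.pow_const ?_ a
  exact hδ.measurable.comp ((measurable_pi_apply i).prodMk (hZ i))

lemma meanMovement_nonneg (hδ : IsDisplacement δ) (X : Fin n → Fin d → ℝ) :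
    0 ≤ meanMovement δ a X :=
  div_nonneg (Finset.sum_nonneg fun _ _ => totalMovement_nonneg hδ _ _) (Nat.cast_nonneg _)

/-! ### The choices of `LV` depend only on the subcubes of the sensors -/

lemma occupants_congr {q : ℕ} {X Y : Fin n → Fin d → ℝ}
    (h : ∀ i, cellIndex q (X i) = cellIndex q (Y i)) : occupants q X = occupants q Y := by
  funext c
  simp only [occupants, h]

lemma underpopulated_congr {X Y : Fin n → Fin d → ℝ}
    (h : ∀ i, cellIndex (edgeCells d a n) (X i) = cellIndex (edgeCells d a n) (Y i)) :
    Underpopulated a X ↔ Underpopulated a Y := by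
  simp only [Underpopulated, occupants_congr h]

lemma lvChoices_congr {X Y : Fin n → Fin d → ℝ}
    (h : ∀ i, cellIndex (edgeCells d a n) (X i) = cellIndex (edgeCells d a n) (Y i)) :
    lvChoices a X = lvChoices a Y := by
  ext S
  by_cases hX : Underpopulated a X
  · rw [mem_lvChoices_of_underpopulated hX,
      mem_lvChoices_of_underpopulated ((underpopulated_congr h).1 hX)]
  · rw [mem_lvChoices_of_not_underpopulated hX, mem_lvChoices_of_not_underpopulated
      fun hY => hX ((underpopulated_congr h).2 hY), occupants_congr h]

lemma measurable_meanMovement (hδ : IsDisplacement δ) :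
    Measurable fun X : Fin n → Fin d → ℝ => meanMovement δ a X := by
  classical
  have hs : Measurable fun (X : Fin n → Fin d → ℝ) (i : Fin n) =>
      cellIndex (edgeCells d a n) (X i) :=
    measurable_pi_iff.2 fun i => (measurable_cellIndex _).comp (measurable_pi_apply i)
  refine measurable_of_fiberwise hs fun c => ?_
  by_cases hc : ∃ Y : Fin n → Fin d → ℝ, (fun i => cellIndex (edgeCells d a n) (Y i)) = c
  · obtain ⟨Y, rfl⟩ := hc
    by_cases hY : Underpopulated a Y
    · refine ⟨fun X => (∑ S ∈ lvChoices a Y, totalMovement δ a X (MV d (edgeAll d n) 1 0 S X)) /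
        (lvChoices a Y).card, ?_, fun X hX => ?_⟩
      · refine Measurable.div_const (Finset.measurable_sum _ fun S _ =>
          measurable_totalMovement hδ fun i => ?_) _
        exact (measurable_pi_apply i).comp (measurable_MV S)
      · have hXY := congrFun hX
        rw [meanMovement, lvChoices_congr hXY]
        simp only [LV_of_underpopulated ((underpopulated_congr hXY).2 hY)]
    · refine ⟨fun X => (∑ S ∈ lvChoices a Y, totalMovement δ a X fun i =>
        MV d (edgeChosen d a n) (1 / edgeCells d a n)
          (fun k => (cellIndex (edgeCells d a n) (Y i) k : ℝ) / edgeCells d a n)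
          (S ∩ occupants (edgeCells d a n) Y (cellIndex (edgeCells d a n) (Y i))) X i) /
        (lvChoices a Y).card, ?_, fun X hX => ?_⟩
      · refine Measurable.div_const (Finset.measurable_sum _ fun S _ =>
          measurable_totalMovement hδ fun i => ?_) _
        exact (measurable_pi_apply i).comp (measurable_MV _)
      · have hXY := congrFun hX
        have hX' : ¬ Underpopulated a X := fun h => hY ((underpopulated_congr hXY).1 h)
        rw [meanMovement, lvChoices_congr hXY]
        congr 1
        refine Finset.sum_congr rfl fun S _ => ?_
        congr 1
        funext i
        have hi : cellIndex (edgeCells d a n) (X i) = cellIndex (edgeCells d a n) (Y i) := hXY i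
        rw [LV_of_not_underpopulated hX', occupants_congr hXY, hi]
  · exact ⟨fun _ => 0, measurable_const, fun X hX => (hc ⟨X, hX⟩).elim⟩

/-! ### The expected movement in the fallback case -/

/-- Splitting a power at the threshold `θ`: above it, the higher moment is larger. -/
lemma le_add_inv_pow_mul {θ u : ℝ} (hθ : 0 < θ) (hu : 0 ≤ u) : u ≤ θ + (θ ^ 4)⁻¹ * u ^ 5 := by
  rcases le_total u θ with h | h
  · have : 0 ≤ (θ ^ 4)⁻¹ * u ^ 5 := by positivity
    linarith
  · have : u ≤ (θ ^ 4)⁻¹ * u ^ 5 := by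
      rw [inv_mul_eq_div, le_div_iff₀ (by positivity)]
      calc u * θ ^ 4 ≤ u * u ^ 4 := by gcongr
        _ = u ^ 5 := by ring
    linarith

lemma deviation_le_of_threshold {θ : ℝ} (hθ : 0 < θ) (S : Finset (Fin n))
    (X Z : Fin n → Fin d → ℝ) :
    deviation a S X Z ≤ S.card * d * θ + (θ ^ 4)⁻¹ * deviation (a * 5) S X Z := by
  have h : deviation a S X Z ≤ ∑ i ∈ S, ∑ k, (θ + (θ ^ 4)⁻¹ * |Z i k - X i k| ^ (a * 5)) := by
    refine Finset.sum_le_sum fun i _ => Finset.sum_le_sum fun k _ => ?_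
    have := le_add_inv_pow_mul hθ (Real.rpow_nonneg (abs_nonneg (Z i k - X i k)) a)
    rwa [← Real.rpow_natCast (|Z i k - X i k| ^ a), ← Real.rpow_mul (abs_nonneg _),
      Nat.cast_ofNat] at this
  refine h.trans (le_of_eq ?_)
  simp only [deviation, Finset.sum_add_distrib, Finset.sum_const, Finset.card_univ,
    Fintype.card_fin, nsmul_eq_mul, Finset.mul_sum]
  ring

/-- On the fallback event the positions are not independent, so the movement is compared with its
fifth power, whose expectation is computed without conditioning. -/
lemma lintegral_fallback_le (hδ : IsDisplacement δ) (ha : 0 < a)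
    {K : ℝ} (hK : 0 < K) {m M : ℕ} (hm : edgeAll d n = m) (hM : m ^ d = M)
    (hmoment : ∀ S : Finset (Fin n), S.card = M →
      ∫⁻ X, ENNReal.ofReal (deviation (a * 5) S X (MV d m 1 0 S X)) ∂sensorLaw n d ≤
        ENNReal.ofReal (K * M * (1 / √m) ^ (a * 5)))
    {θ P : ℝ} (hθ : 0 < θ) (hP : 0 ≤ P)
    (hprob : sensorLaw n d {X | Underpopulated a X} ≤ ENNReal.ofReal P)
    (hne : ∀ X : Fin n → Fin d → ℝ, (lvChoices a X).Nonempty) :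
    ∫⁻ X in {X | Underpopulated a X}, ENNReal.ofReal (meanMovement δ a X) ∂sensorLaw n d ≤
      ENNReal.ofReal ((d : ℝ) ^ a * (M * d * θ) * P +
        (d : ℝ) ^ a * (θ ^ 4)⁻¹ * (K * M * (1 / √m) ^ (a * 5))) := by
  classical
  set U := {X : Fin n → Fin d → ℝ | Underpopulated a X} with hU
  set T : Finset (Finset (Fin n)) := Finset.powersetCard M Finset.univ with hT
  set c₁ : ℝ := (d : ℝ) ^ a * (M * d * θ) with hc₁
  set c₂ : ℝ := (d : ℝ) ^ a * (θ ^ 4)⁻¹ with hc₂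
  have hpt : ∀ X ∈ U, ENNReal.ofReal (meanMovement δ a X) ≤ ENNReal.ofReal c₁ +
      ENNReal.ofReal (c₂ / T.card) *
        ∑ S ∈ T, ENNReal.ofReal (deviation (a * 5) S X (MV d m 1 0 S X)) := by
    intro X hX
    have hlv : lvChoices a X = T := by
      ext S
      rw [mem_lvChoices_of_underpopulated hX, hT, Finset.mem_powersetCard, hm, hM]
      simp
    have hT0 : (0 : ℝ) < T.card := by
      have := Finset.card_pos.2 (hne X)
      rw [hlv] at this
      exact_mod_cast this
    rw [← ENNReal.ofReal_sum_of_nonneg (fun _ _ => deviation_nonneg _ _ _ _),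
      ← ENNReal.ofReal_mul (by positivity), ← ENNReal.ofReal_add (by positivity)
        (mul_nonneg (by positivity) (Finset.sum_nonneg fun _ _ => deviation_nonneg _ _ _ _))]
    apply ENNReal.ofReal_le_ofReal
    rw [meanMovement, hlv, div_le_iff₀ hT0]
    calc ∑ S ∈ T, totalMovement δ a X (LV a X S)
        ≤ ∑ S ∈ T, (c₁ + c₂ * deviation (a * 5) S X (MV d m 1 0 S X)) := by
          refine Finset.sum_le_sum fun S hS => ?_
          have hSc : S.card = M := (Finset.mem_powersetCard.1 hS).2
          rw [LV_of_underpopulated hX, hm]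
          refine (totalMovement_le_deviation hδ ha fun i hi => MV_of_notMem hi).trans ?_
          have := deviation_le_of_threshold (a := a) hθ S X (MV d m 1 0 S X)
          rw [hSc] at this
          calc _ ≤ (d : ℝ) ^ a * (M * d * θ +
                (θ ^ 4)⁻¹ * deviation (a * 5) S X (MV d m 1 0 S X)) := by gcongr
            _ = _ := by rw [hc₁, hc₂]; ring
      _ = _ := by
          rw [Finset.sum_add_distrib, Finset.sum_const, nsmul_eq_mul, ← Finset.mul_sum]
          field_simp
  calc _ ≤ ∫⁻ X in U, (ENNReal.ofReal c₁ + ENNReal.ofReal (c₂ / T.card) *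
        ∑ S ∈ T, ENNReal.ofReal (deviation (a * 5) S X (MV d m 1 0 S X))) ∂sensorLaw n d :=
        setLIntegral_mono' (measurableSet_underpopulated a) hpt
    _ = ENNReal.ofReal c₁ * sensorLaw n d U + ENNReal.ofReal (c₂ / T.card) *
        ∑ S ∈ T, ∫⁻ X in U, ENNReal.ofReal (deviation (a * 5) S X (MV d m 1 0 S X))
          ∂sensorLaw n d := by
        rw [lintegral_add_left measurable_const, setLIntegral_const,
          lintegral_const_mul' _ _ ENNReal.ofReal_ne_top,
          lintegral_finsetSum _ fun S _ => (measurable_deviation_MV _ S).ennreal_ofReal]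
    _ ≤ ENNReal.ofReal c₁ * ENNReal.ofReal P + ENNReal.ofReal (c₂ / T.card) *
        ∑ S ∈ T, ENNReal.ofReal (K * M * (1 / √m) ^ (a * 5)) := by
        gcongr with S hS
        exact (setLIntegral_le_lintegral _ _).trans (hmoment S (Finset.mem_powersetCard.1 hS).2)
    _ ≤ _ := by
        rw [Finset.sum_const, nsmul_eq_mul, ← ENNReal.ofReal_natCast,
          ← ENNReal.ofReal_mul (by positivity), ← ENNReal.ofReal_mul (by positivity),
          ← ENNReal.ofReal_mul (by positivity),
          ← ENNReal.ofReal_add (by positivity) (by positivity)]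
        apply ENNReal.ofReal_le_ofReal
        have h0 : c₂ / T.card * T.card ≤ c₂ := by
          rcases Nat.eq_zero_or_pos T.card with h | h
          · rw [h]; simp; positivity
          · have : (0 : ℝ) < T.card := by exact_mod_cast h
            rw [div_mul_cancel₀ _ this.ne']
        rw [← mul_assoc]
        gcongr

/-! ### The expected movement in the regular case -/

/-- In the regular case the movement is bounded subcube by subcube. -/
lemma meanMovement_le_of_not_underpopulated (hδ : IsDisplacement δ) (ha : 0 < a)
    {q m : ℕ} (hq : edgeCells d a n = q) (hq0 : 0 < q) (hm : edgeChosen d a n = m)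
    {X : Fin n → Fin d → ℝ} (hX : ¬ Underpopulated a X) :
    meanMovement δ a X ≤ (d : ℝ) ^ a / (lvChoices a X).card * ∑ S ∈ lvChoices a X,
      ∑ c : Fin d → Fin q, deviation a (S ∩ occupants q X fun k => (c k : ℕ)) X
        (MV d m (1 / q) (fun k => (c k : ℝ) / q) (S ∩ occupants q X fun k => (c k : ℕ)) X) := by
  classical
  subst hq hm
  set q := edgeCells d a n
  rw [meanMovement, div_eq_inv_mul, div_eq_inv_mul, mul_assoc]
  gcongr
  rw [Finset.mul_sum]
  refine Finset.sum_le_sum fun S _ => ?_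
  set κ : Fin n → Fin d → Fin q := fun i k => ⟨cellIndex q (X i) k, cellIndex_lt hq0 _ _⟩ with hκ
  rw [totalMovement, ← Finset.sum_fiberwise_of_maps_to (g := κ) (t := Finset.univ)
    (fun _ _ => Finset.mem_univ _), Finset.mul_sum]
  refine Finset.sum_le_sum fun c _ => ?_
  refine le_trans ?_ (totalMovement_le_deviation hδ ha fun i hi => MV_of_notMem hi)
  rw [totalMovement]
  refine le_trans (le_of_eq ?_) (Finset.sum_le_sum_of_subset_of_nonneg (Finset.filter_subset
    (fun i => κ i = c) Finset.univ) fun i _ _ => Real.rpow_nonneg (hδ.nonneg _ _) _)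
  refine Finset.sum_congr rfl fun i hi => ?_
  have hi' : κ i = c := (Finset.mem_filter.1 hi).2
  have hc : cellIndex q (X i) = fun k => (c k : ℕ) := by
    rw [← hi']
  rw [LV_of_not_underpopulated hX, hc]

lemma lintegral_regular_le (hδ : IsDisplacement δ) (ha : 0 < a) {K : ℝ} (hK : 0 < K)
    {q m : ℕ} (hq : edgeCells d a n = q) (hq0 : 0 < q) (hm : edgeChosen d a n = m)
    (hmoment : ∀ (σ : Fin n → Fin d → Fin q) (S : Finset (Fin n)) (c : Fin d → Fin q),
      S.card = m ^ d → (∀ i ∈ S, σ i = c) →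
      ∫⁻ X, ENNReal.ofReal (deviation a S X (MV d m (1 / q) (fun k => (c k : ℝ) / q) S X))
        ∂cellsLaw σ ≤ ENNReal.ofReal (K * m ^ d * (1 / q / √m) ^ a)) :
    ∫⁻ X in {X | Underpopulated a X}ᶜ, ENNReal.ofReal (meanMovement δ a X) ∂sensorLaw n d ≤
      ENNReal.ofReal ((d : ℝ) ^ a * (q ^ d * (K * m ^ d * (1 / q / √m) ^ a))) := by
  classical
  rw [← lintegral_indicator (measurableSet_underpopulated a).compl]
  refine lintegral_sensorLaw_le_of_cells hq0 fun σ => ?_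
  by_cases hσ : ∃ Y : Fin n → Fin d → ℝ, (∀ i, cellIndex q (Y i) = fun k => (σ i k : ℕ)) ∧
      ¬ Underpopulated a Y
  · obtain ⟨Y, hY, hYU⟩ := hσ
    set T := lvChoices a Y with hT
    have hpt : ∀ᵐ X ∂cellsLaw σ, {X | Underpopulated a X}ᶜ.indicator
        (fun X => ENNReal.ofReal (meanMovement δ a X)) X ≤
        ENNReal.ofReal ((d : ℝ) ^ a / T.card) * ∑ S ∈ T, ∑ c : Fin d → Fin q,
          ENNReal.ofReal (deviation a (S ∩ occupants q Y fun k => (c k : ℕ)) X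
            (MV d m (1 / q) (fun k => (c k : ℝ) / q)
              (S ∩ occupants q Y fun k => (c k : ℕ)) X)) := by
      filter_upwards [ae_cellsLaw hq0 σ] with X hX
      have hXY : ∀ i, cellIndex q (X i) = cellIndex q (Y i) := fun i => (hX i).trans (hY i).symm
      have hXU : ¬ Underpopulated a X := by
        rwa [underpopulated_congr (Y := Y) (by rwa [hq])]
      refine (Set.indicator_le_self' (fun _ _ => zero_le) X).trans ?_
      have := meanMovement_le_of_not_underpopulated hδ ha hq hq0 hm hXU
      rw [lvChoices_congr (Y := Y) (by rwa [hq]), occupants_congr hXY] at this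
      refine (ENNReal.ofReal_le_ofReal this).trans (le_of_eq ?_)
      rw [ENNReal.ofReal_mul (by positivity), ENNReal.ofReal_sum_of_nonneg
        (fun _ _ => Finset.sum_nonneg fun _ _ => deviation_nonneg _ _ _ _)]
      congr 1
      refine Finset.sum_congr rfl fun S _ => ?_
      rw [ENNReal.ofReal_sum_of_nonneg (fun _ _ => deviation_nonneg _ _ _ _)]
    have hSc : ∀ S ∈ T, ∀ c : Fin d → Fin q,
        (S ∩ occupants q Y fun k => (c k : ℕ)).card = m ^ d := by
      intro S hS c
      subst hq hm
      exact (mem_lvChoices_of_not_underpopulated hYU).1 hS c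
    calc _ ≤ _ := lintegral_mono_ae hpt
      _ = ENNReal.ofReal ((d : ℝ) ^ a / T.card) * ∑ S ∈ T, ∑ c : Fin d → Fin q,
          ∫⁻ X, ENNReal.ofReal (deviation a (S ∩ occupants q Y fun k => (c k : ℕ)) X
            (MV d m (1 / q) (fun k => (c k : ℝ) / q)
              (S ∩ occupants q Y fun k => (c k : ℕ)) X)) ∂cellsLaw σ := by
        have hmeas : ∀ (S : Finset (Fin n)) (c : Fin d → Fin q),
            Measurable fun X : Fin n → Fin d → ℝ => ENNReal.ofReal
              (deviation a (S ∩ occupants q Y fun k => (c k : ℕ)) X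
                (MV d m (1 / q) (fun k => (c k : ℝ) / q)
                  (S ∩ occupants q Y fun k => (c k : ℕ)) X)) :=
          fun S c => (measurable_deviation_MV _ _).ennreal_ofReal
        rw [lintegral_const_mul' _ _ ENNReal.ofReal_ne_top,
          lintegral_finsetSum _ fun S _ => Finset.measurable_sum _ fun c _ => hmeas S c]
        congr 1
        refine Finset.sum_congr rfl fun S _ => ?_
        rw [lintegral_finsetSum _ fun c _ => hmeas S c]
      _ ≤ ENNReal.ofReal ((d : ℝ) ^ a / T.card) * ∑ S ∈ T, ∑ c : Fin d → Fin q,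
          ENNReal.ofReal (K * m ^ d * (1 / q / √m) ^ a) := by
        gcongr with S hS c
        refine hmoment σ _ c (hSc S hS c) fun i hi => ?_
        have h1 := mem_occupants.1 (Finset.mem_inter.1 hi).2
        funext k
        exact Fin.ext (congrFun ((hY i).symm.trans h1) k)
      _ ≤ _ := by
        simp only [Finset.sum_const, nsmul_eq_mul, Finset.card_univ, Fintype.card_fun,
          Fintype.card_fin]
        rw [← ENNReal.ofReal_natCast, ← ENNReal.ofReal_natCast,
          ← ENNReal.ofReal_mul (by positivity), ← ENNReal.ofReal_mul (by positivity),
          ← ENNReal.ofReal_mul (by positivity)]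
        apply ENNReal.ofReal_le_ofReal
        have h0 : (d : ℝ) ^ a / T.card * T.card ≤ (d : ℝ) ^ a := by
          rcases Nat.eq_zero_or_pos T.card with h | h
          · rw [h]; simp; positivity
          · have : (0 : ℝ) < T.card := by exact_mod_cast h
            rw [div_mul_cancel₀ _ this.ne']
        rw [← mul_assoc]
        push_cast
        gcongr
  · push Not at hσ
    have hzero : ∀ᵐ X ∂cellsLaw σ, {X | Underpopulated a X}ᶜ.indicator
        (fun X => ENNReal.ofReal (meanMovement δ a X)) X = 0 := by
      filter_upwards [ae_cellsLaw hq0 σ] with X hX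
      have hXU : X ∉ {X : Fin n → Fin d → ℝ | Underpopulated a X}ᶜ :=
        Set.notMem_compl_iff.2 (hσ X hX)
      exact Set.indicator_of_notMem hXU _
    rw [lintegral_congr_ae hzero]
    simp
end

/-! ### The asymptotic estimate -/

lemma div_sqrt_rpow {y m b : ℝ} (hy : 0 ≤ y) (hm : 0 ≤ m) :
    (y / √m) ^ b = y ^ b * m ^ (-(b / 2)) := by
  rw [Real.div_rpow hy (Real.sqrt_nonneg m), Real.sqrt_eq_rpow, ← Real.rpow_mul hm,
    Real.rpow_neg hm, div_eq_mul_inv]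
  congr 3; ring

lemma rpow_one_div_rpow {d : ℕ} {z b : ℝ} (hz : 0 ≤ z) :
    (z ^ (1 / (d : ℝ))) ^ b = z ^ (b / d) := by
  rw [← Real.rpow_mul hz]; congr 1; ring

/-- A negative power of a rounded `d`-th root. -/
lemma floor_rpow_neg_le {d : ℕ} (hd : 0 < d) {z b : ℝ} (hz : 3 ≤ z) (hb : 0 ≤ b) :
    (⌊z ^ (1 / (d : ℝ))⌋₊ : ℝ) ^ (-b) ≤ roundingRatio d ^ (-b) * z ^ (-(b / d)) := by
  have hr := roundingRatio_pos hd
  have hz0 : 0 < z := by linarith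
  calc (⌊z ^ (1 / (d : ℝ))⌋₊ : ℝ) ^ (-b) ≤ (z ^ (1 / (d : ℝ)) * roundingRatio d) ^ (-b) :=
        Real.rpow_le_rpow_of_nonpos (by positivity) (floor_rpow_bounds hd hz).2.1 (by linarith)
    _ = roundingRatio d ^ (-b) * z ^ (-(b / d)) := by
        rw [Real.mul_rpow (by positivity) hr.le, rpow_one_div_rpow hz0.le, mul_comm, neg_div]

lemma rate_eq {n L : ℝ} (hn : 0 < n) (hL : 0 ≤ L) (d a : ℝ) :
    n ^ (1 - a / (2 * d)) * (L / n) ^ (a / (2 * d)) = n * n ^ (-(a / d)) * L ^ (a / d / 2) := by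
  rw [Real.div_rpow hL hn.le, show n * n ^ (-(a / d)) = n ^ (1 - a / d) by
    rw [sub_eq_add_neg, Real.rpow_add hn, Real.rpow_one],
    show 1 - a / d = (1 - a / (2 * d)) - a / (2 * d) by ring, Real.rpow_sub hn (1 - a / (2 * d)),
    show a / d / 2 = a / (2 * d) by ring]
  ring

section
variable {n d : ℕ} {a : ℝ}

/-- The threshold `θ = n ^ (-3a/(8d))` balances the two contributions of the fallback case. -/
lemma fallback_rate_le (hd : 0 < d) (ha : 0 < a) {K : ℝ} (hK : 0 < K) (hl : 1 ≤ Real.log n)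
    (hn : 3 ≤ (n : ℝ)) :
    (d : ℝ) ^ a * (((edgeAll d n ^ d : ℕ) : ℝ) * d * (n : ℝ) ^ (-(3 / 8 * (a / d)))) *
        (n : ℝ) ^ (-(5 / 8 * (a / d))) +
      (d : ℝ) ^ a * (((n : ℝ) ^ (-(3 / 8 * (a / d)))) ^ 4)⁻¹ *
        (K * ((edgeAll d n ^ d : ℕ) : ℝ) * (1 / √(edgeAll d n)) ^ (a * 5)) ≤
      (d : ℝ) ^ a * (d + K * roundingRatio d ^ (-(a * 5 / 2))) *
        (n * (n : ℝ) ^ (-(a / d)) * Real.log n ^ (a / d / 2)) := by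
  have hn0 : (0 : ℝ) < n := by linarith
  have hr := roundingRatio_pos hd
  have hM : ((edgeAll d n ^ d : ℕ) : ℝ) ≤ n := by
    push_cast; exact (floor_rpow_bounds hd hn).2.2.2
  have hm : (1 / √(edgeAll d n)) ^ (a * 5) ≤
      roundingRatio d ^ (-(a * 5 / 2)) * (n : ℝ) ^ (-(5 / 2 * (a / d))) := by
    rw [div_sqrt_rpow zero_le_one (Nat.cast_nonneg _), Real.one_rpow, one_mul]
    refine (floor_rpow_neg_le hd hn (by positivity)).trans (le_of_eq ?_)
    congr 2; ring
  have hL : 1 ≤ Real.log n ^ (a / d / 2) := Real.one_le_rpow hl (by positivity)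
  have e1 : (n : ℝ) ^ (-(3 / 8 * (a / d))) * (n : ℝ) ^ (-(5 / 8 * (a / d))) =
      (n : ℝ) ^ (-(a / d)) := by
    rw [← Real.rpow_add hn0]; congr 1; ring
  have e2 : (((n : ℝ) ^ (-(3 / 8 * (a / d)))) ^ 4)⁻¹ = (n : ℝ) ^ (3 / 2 * (a / d)) := by
    rw [← Real.rpow_natCast, ← Real.rpow_mul hn0.le, ← Real.rpow_neg hn0.le]
    congr 1; push_cast; ring
  have e3 : (n : ℝ) ^ (3 / 2 * (a / d)) * (n : ℝ) ^ (-(5 / 2 * (a / d))) =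
      (n : ℝ) ^ (-(a / d)) := by
    rw [← Real.rpow_add hn0]; congr 1; ring
  rw [e2]
  calc _ ≤ (d : ℝ) ^ a * (n * d * (n : ℝ) ^ (-(3 / 8 * (a / d)))) *
        (n : ℝ) ^ (-(5 / 8 * (a / d))) +
      (d : ℝ) ^ a * (n : ℝ) ^ (3 / 2 * (a / d)) *
        (K * n * (roundingRatio d ^ (-(a * 5 / 2)) * (n : ℝ) ^ (-(5 / 2 * (a / d))))) := by
        gcongr
    _ = (d : ℝ) ^ a * n * d * ((n : ℝ) ^ (-(3 / 8 * (a / d))) * (n : ℝ) ^ (-(5 / 8 * (a / d)))) +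
      (d : ℝ) ^ a * (K * n * roundingRatio d ^ (-(a * 5 / 2))) *
        ((n : ℝ) ^ (3 / 2 * (a / d)) * (n : ℝ) ^ (-(5 / 2 * (a / d)))) := by ring
    _ = (d : ℝ) ^ a * (d + K * roundingRatio d ^ (-(a * 5 / 2))) *
        (n * (n : ℝ) ^ (-(a / d)) * 1) := by rw [e1, e3]; ring
    _ ≤ _ := by gcongr

lemma regular_rate_le (hd : 0 < d) (ha : 0 < a) {K : ℝ} (hK : 0 < K) (hl : 1 ≤ Real.log n)
    (hn : 3 ≤ (n : ℝ)) (h1 : 3 ≤ n / (pConst d a * Real.log n))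
    (h2 : 3 ≤ aConst d a * Real.log n) :
    (d : ℝ) ^ a * ((edgeCells d a n : ℝ) ^ d * (K * (edgeChosen d a n : ℝ) ^ d *
        (1 / edgeCells d a n / √(edgeChosen d a n)) ^ a)) ≤
      (d : ℝ) ^ a * K * (roundingRatio d ^ (-a) * pConst d a ^ (a / d) *
        (roundingRatio d ^ (-(a / 2)) * aConst d a ^ (-(a / d / 2)))) *
        (n * (n : ℝ) ^ (-(a / d)) * Real.log n ^ (a / d / 2)) := by
  have hn0 : (0 : ℝ) < n := by linarith
  have hr := roundingRatio_pos hd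
  have hp0 : 0 < pConst d a := by linarith [le_pConst d ha]
  have hA := aConst_pos d ha
  obtain ⟨hq0, -, -, hq⟩ := floor_rpow_bounds hd h1
  obtain ⟨-, -, -, hm⟩ := floor_rpow_bounds hd h2
  have hqr := floor_rpow_neg_le hd h1 ha.le
  have hmr := floor_rpow_neg_le hd h2 (show 0 ≤ a / 2 by positivity)
  change (edgeCells d a n : ℝ) ^ d ≤ _ at hq
  change (edgeChosen d a n : ℝ) ^ d ≤ _ at hm
  change (edgeCells d a n : ℝ) ^ (-a) ≤ _ at hqr
  change (edgeChosen d a n : ℝ) ^ (-(a / 2)) ≤ _ at hmr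
  set L := Real.log n with hLdef
  have hL0 : 0 < L := by linarith
  have hqm : (edgeCells d a n : ℝ) ^ d * (edgeChosen d a n : ℝ) ^ d ≤ n := by
    calc _ ≤ n / (pConst d a * L) * (aConst d a * L) := by gcongr
      _ = n / 3 := by rw [pConst_eq]; field_simp
      _ ≤ n := by linarith
  have hcost : (1 / (edgeCells d a n : ℝ) / √(edgeChosen d a n)) ^ a ≤
      (roundingRatio d ^ (-a) * pConst d a ^ (a / d) *
        (roundingRatio d ^ (-(a / 2)) * aConst d a ^ (-(a / d / 2)))) *
        ((n : ℝ) ^ (-(a / d)) * L ^ (a / d / 2)) := by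
    rw [div_sqrt_rpow (by positivity) (Nat.cast_nonneg _), one_div,
      ← Real.rpow_neg_eq_inv_rpow]
    refine (mul_le_mul hqr hmr (by positivity) (by positivity)).trans (le_of_eq ?_)
    have e1 : (n / (pConst d a * L)) ^ (-(a / d)) =
        (n : ℝ) ^ (-(a / d)) * pConst d a ^ (a / d) * L ^ (a / d) := by
      rw [Real.div_rpow hn0.le (by positivity), Real.mul_rpow hp0.le hL0.le,
        Real.rpow_neg hp0.le, Real.rpow_neg hL0.le]
      field_simp
    have e2 : (aConst d a * L) ^ (-(a / 2 / d)) =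
        aConst d a ^ (-(a / d / 2)) * L ^ (-(a / d / 2)) := by
      rw [Real.mul_rpow hA.le hL0.le, show a / 2 / (d : ℝ) = a / d / 2 by ring]
    have e3 : L ^ (a / d) * L ^ (-(a / d / 2)) = L ^ (a / d / 2) := by
      rw [← Real.rpow_add hL0]; congr 1; ring
    rw [e1, e2, ← e3]
    ring
  calc _ = (d : ℝ) ^ a * K * (((edgeCells d a n : ℝ) ^ d * (edgeChosen d a n : ℝ) ^ d) *
        (1 / (edgeCells d a n : ℝ) / √(edgeChosen d a n)) ^ a) := by ring
    _ ≤ (d : ℝ) ^ a * K * (n * ((roundingRatio d ^ (-a) * pConst d a ^ (a / d) *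
        (roundingRatio d ^ (-(a / 2)) * aConst d a ^ (-(a / d / 2)))) *
        ((n : ℝ) ^ (-(a / d)) * L ^ (a / d / 2)))) := by gcongr
    _ = _ := by ring

end

/-- The expected movement of `LV`, as a lower Lebesgue integral. -/
lemma exists_lintegral_meanMovement_le {d : ℕ} (hd : 0 < d) {a : ℝ} (ha : 0 < a) :
    ∃ C : ℝ, 0 < C ∧ ∀ {n : ℕ}, 3 ≤ (n : ℝ) → 1 ≤ Real.log n →
      3 ≤ n / (pConst d a * Real.log n) → 3 ≤ aConst d a * Real.log n →
      ∀ {δ : (Fin d → ℝ) → (Fin d → ℝ) → ℝ}, IsDisplacement δ →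
      ∫⁻ X, ENNReal.ofReal (meanMovement δ a X) ∂sensorLaw n d ≤ ENNReal.ofReal
        (C * ((n : ℝ) ^ (1 - a / (2 * d)) * (Real.log n / n) ^ (a / (2 * d)))) := by
  obtain ⟨K, hK, hKs⟩ := exists_lintegral_deviation_MV_le ha d
  obtain ⟨K₅, hK₅, hKs₅⟩ := exists_lintegral_deviation_MV_le (b := a * 5) (by positivity) d
  have hr := roundingRatio_pos hd
  have hp0 : 0 < pConst d a := by linarith [le_pConst d ha]
  have hA := aConst_pos d ha
  refine ⟨(d : ℝ) ^ a * (d + K₅ * roundingRatio d ^ (-(a * 5 / 2))) +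
    (d : ℝ) ^ a * K * (roundingRatio d ^ (-a) * pConst d a ^ (a / d) *
      (roundingRatio d ^ (-(a / 2)) * aConst d a ^ (-(a / d / 2)))), by positivity, ?_⟩
  intro n hn hl h1 h2 δ hδ
  have hn0 : (0 : ℝ) < n := by linarith
  have hm0 : 0 < edgeAll d n := (floor_rpow_bounds hd hn).1
  have hq0 : 0 < edgeCells d a n := (floor_rpow_bounds hd h1).1
  have hc0 : 0 < edgeChosen d a n := (floor_rpow_bounds hd h2).1
  have hB := lintegral_fallback_le hδ ha hK₅ (n := n) rfl rfl (fun S hS => by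
      have := isProbabilityMeasure_unif 0 one_pos
      have h := hKs₅ (n := n) (ν := fun _ _ => unif 0 1) (o := 0) one_pos hm0 hS
        (fun _ _ _ => rfl)
      simp only [unif_zero_one, ← volume_restrict_Icc_eq_pi] at h
      push_cast
      exact h)
    (Real.rpow_pos_of_pos hn0 (-(3 / 8 * (a / d)))) (by positivity)
    (sensorLaw_underpopulated_le hd ha hl h1)
    (fun X => lvChoices_nonempty hd ha hl h1 h2)
  have hR := lintegral_regular_le hδ ha hK (n := n) rfl hq0 rfl (fun σ S c hS hσ => by
      have := isProbabilityMeasure_cell hq0 σ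
      exact hKs (ν := fun i k => unif ((σ i k : ℝ) / edgeCells d a n) (1 / edgeCells d a n))
        (o := fun k => (c k : ℝ) / edgeCells d a n) (by positivity) hc0 hS
        (fun i hi k => by rw [hσ i hi]))
  rw [← lintegral_add_compl _ (measurableSet_underpopulated a), add_mul,
    ENNReal.ofReal_add (by positivity) (by positivity), rate_eq hn0 (by linarith)]
  exact add_le_add
    (hB.trans (ENNReal.ofReal_le_ofReal (fallback_rate_le hd ha hK₅ hl hn)))
    (hR.trans (ENNReal.ofReal_le_ofReal (regular_rate_le hd ha hK hl hn h1 h2)))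

end SensorCover

theorem theorem2p2 (d : ℕ) (hd : 2 ≤ d) (a : ℝ) (ha : 0 < a)
    (x₀ : ℝ) (hx₀ : 3 ≤ x₀) (hx₀' : x₀ / (9 / 4 * (2 + a / d) * Real.log x₀) = 3) :
    ∃ C : ℝ, 0 < C ∧ ∀ (f : ℝ) (n : ℕ),
      (3 : ℝ) ^ (3 / (d : ℝ)) /
        (((3 : ℝ) ^ (1 / (d : ℝ)) - 1) * ((3 : ℝ) ^ (1 / (d : ℝ)) - 1)) ≤ f →
      ⌈x₀⌉₊ ≤ n →
      (∀ X : Fin n → Fin d → ℝ, (∀ i, X i ∈ Set.Icc (0 : Fin d → ℝ) 1) →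
        (SensorCover.lvChoices a X).Nonempty ∧
        ∀ S ∈ SensorCover.lvChoices a X,
          SensorCover.Covers (f / (2 * (n : ℝ) ^ (1 / (d : ℝ)))) (SensorCover.LV a X S)) ∧
      ∀ δ : (Fin d → ℝ) → (Fin d → ℝ) → ℝ,
        δ = SensorCover.euclideanDisplacement ∨ δ = SensorCover.distanceTravelled →
        MeasureTheory.Integrable (fun X : Fin n → Fin d → ℝ => SensorCover.meanMovement δ a X)
          (SensorCover.sensorLaw n d) ∧
        ∫ X : Fin n → Fin d → ℝ, SensorCover.meanMovement δ a X ∂(SensorCover.sensorLaw n d) ≤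
          C * ((n : ℝ) ^ (1 - a / (2 * d)) * (Real.log n / n) ^ (a / (2 * d))) := by
  have hd0 : 0 < d := by omega
  obtain ⟨C, hC, hmean⟩ := SensorCover.exists_lintegral_meanMovement_le hd0 ha
  refine ⟨C, hC, fun f n hf hn => ?_⟩
  obtain ⟨hl, h1, h2⟩ := SensorCover.log_bounds ha hx₀ hx₀' hn
  have hn3 : (3 : ℝ) ≤ n := hx₀.trans (Nat.ceil_le.1 hn)
  refine ⟨fun X _ => ⟨SensorCover.lvChoices_nonempty hd0 ha hl h1 h2, fun S hS =>
    SensorCover.LV_covers hd0 ha hl hn3 h1 h2 hf hS⟩, fun δ hδ => ?_⟩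
  have hδ' : SensorCover.IsDisplacement δ := by
    rcases hδ with rfl | rfl
    · exact SensorCover.isDisplacement_euclidean d
    · exact SensorCover.isDisplacement_distanceTravelled d
  have hle := hmean hn3 hl h1 h2 hδ'
  have hmeas := SensorCover.measurable_meanMovement (n := n) (a := a) hδ'
  have hnn : ∀ X : Fin n → Fin d → ℝ, 0 ≤ SensorCover.meanMovement δ a X :=
    SensorCover.meanMovement_nonneg hδ'
  refine ⟨⟨hmeas.aestronglyMeasurable, ?_⟩, ?_⟩
  · rw [hasFiniteIntegral_iff_ofReal (Filter.Eventually.of_forall hnn)]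
    exact hle.trans_lt ENNReal.ofReal_lt_top
  · rw [integral_eq_lintegral_of_nonneg_ae (Filter.Eventually.of_forall hnn)
      hmeas.aestronglyMeasurable]
    exact ENNReal.toReal_le_of_le_ofReal (by positivity) hle
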